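/- **Definitions.** For $n\in\mathbb N$, $d\ge 1$ and $\lambda\in\mathbb R$ with $|\lambda|\le\sqrt d$, the stochastic block model $\mathrm{SBM}(n,d,\lambda)$ is the law of the following random graph on $[n]$: draw $\sigma\in\{\pm1\}^n$ uniformly and, given $\sigma$, include each edge $uv$ independently, with probability $\frac{d+\lambda\sqrt d}{n}$ if $\sigma(u)=\sigma(v)$ and $\frac{d-\lambda\sqrt d}{n}$ otherwise (these are probabilities once $n\ge 2d$; only $n\to\infty$ matters). For a graph $G$ and a vertex $v$, let $B_\ell(v)$ be the subgraph of $G$ induced on the vertices at distance at most $\ell$ from $v$, let $|B_\ell(v)|$ be its number of vertices, and for $\varepsilon>0$ let $\ell(v)$ be the least $\ell\ge 0$ such that $|B_L(v)|\le (d(1+\varepsilon))^L$ for all $L\ge\ell$. The near-forest part (excision) of $G$ is the graph $H=\bigcup_{v} B_{\ell(v)}(v)$, regarded as a graph on the whole vertex set. For a connected component $C$ of $H$, $|C|$ is its number of vertices; $C$ is nontrivial if $|C|>1$. **Statement.** There are absolute constants $C_1,C_2,c,c'>0$ such that for all constants $d\ge1$, $\lambda$ with $|\lambda|\le\sqrt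 d$, and $$\varepsilon\ \ge\ C_1\Big(\frac{C_2+\log d}{d}\Big)^{1/3},$$ the following holds for $G\sim\mathrm{SBM}(n,d,\lambda)$ with near-forest part $H$. 1. With probability $1-o(1)$ as $n\to\infty$ (with $d,\lambda,\varepsilon$ fixed), $$\sum_{C\text{ component of }H,\ |C|>1}|C|^2\ \le\ \exp\!\big(-c\,\min\{\varepsilon^3,\varepsilon\}\,d\big)\,n .$$ In particular, for $\varepsilon\le 1$ the bound is $\exp(-c\varepsilon^3 d)\,n$. 2. With probability $1-o(1)$ as $n\to\infty$, every connected component $C$ of $H$ satisfies $$|C|\ \le\ n^{\,c'\log(d(1+\varepsilon))/(\varepsilon^3 d)} .$$ -/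

import Mathlib

open MeasureTheory Filter Topology

noncomputable section

namespace SBMExcision

/-- A community assignment: every vertex gets one of the two signs `±1`. -/
abbrev Labels (n : ℕ) : Type := Fin n → ℤˣ

/-- Probability that the pair `e` is an edge, given the community assignment `σ`:
`(d + lam * √d) / n` inside a community and `(d - lam * √d) / n` across communities. The value is
projected to `[0, 1]`; for `|lam| ≤ √d` this changes nothing as soon as `n ≥ 2 * d`. -/
def edgeProb {n : ℕ} (d lam : ℝ) (σ : Labels n) (e : Sym2 (Fin n)) : unitInterval :=
  open Classical in
  Set.projIcc (0 : ℝ) 1 zero_le_one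
    (if ∀ u ∈ e, ∀ v ∈ e, σ u = σ v then (d + lam * √d) / n else (d - lam * √d) / n)

/-- The law on `{true, false}` giving mass `p` to `true`. -/
def coin (p : unitInterval) : Measure Bool :=
  ENNReal.ofReal (p : ℝ) • Measure.dirac true + ENNReal.ofReal (1 - (p : ℝ)) • Measure.dirac false

instance (p : unitInterval) : IsProbabilityMeasure (coin p) := by
  constructor
  have h : (p : ℝ) + (1 - (p : ℝ)) = 1 := by ring
  simp only [coin, Measure.add_apply, Measure.smul_apply, measure_univ, smul_eq_mul, mul_one]
  rw [← ENNReal.ofReal_add p.2.1 (sub_nonneg.2 p.2.2), h, ENNReal.ofReal_one]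

/-- The graph whose edges are the (non-diagonal) pairs on which `A` is `true`. -/
def graphOf {n : ℕ} (A : Sym2 (Fin n) → Bool) : SimpleGraph (Fin n) :=
  SimpleGraph.fromEdgeSet {e | A e = true}

lemma measurable_graphOf {n : ℕ} : Measurable (graphOf (n := n)) :=
  measurable_of_finite _

/-- The law of the random graph given the community assignment `σ`: independent edges. -/
def sbmGiven {n : ℕ} (d lam : ℝ) (σ : Labels n) : Measure (SimpleGraph (Fin n)) :=
  (Measure.pi fun e : Sym2 (Fin n) => coin (edgeProb d lam σ e)).map graphOf

instance {n : ℕ} (d lam : ℝ) (σ : Labels n) : IsProbabilityMeasure (sbmGiven d lam σ) :=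
  Measure.isProbabilityMeasure_map measurable_graphOf.aemeasurable

/-- The two-community stochastic block model `SBM(n, d, lam)`: the average of `sbmGiven d lam σ`
over uniformly random community assignments `σ`. -/
def sbm (n : ℕ) (d lam : ℝ) : Measure (SimpleGraph (Fin n)) :=
  ∑ σ : Labels n, ((2 : ENNReal) ^ n)⁻¹ • sbmGiven d lam σ

instance (n : ℕ) (d lam : ℝ) : IsProbabilityMeasure (sbm n d lam) := by
  constructor
  simp [sbm, ENNReal.mul_inv_cancel]

variable {V : Type*}

/-- The set of vertices within graph distance `ℓ` of `v`. -/
def ballSet (G : SimpleGraph V) (v : V) (ℓ : ℕ) : Set V :=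
  {u | G.edist v u ≤ ℓ}

/-- `v` is `ℓ`-light (with growth rate `D`) if its `ℓ`-ball has at most `D ^ ℓ` vertices. -/
def IsLight (G : SimpleGraph V) (D : ℝ) (v : V) (ℓ : ℕ) : Prop :=
  ((ballSet G v ℓ).ncard : ℝ) ≤ D ^ ℓ

/-- The least `ℓ ≥ 0` such that `v` is `L`-light for all `L ≥ ℓ`. Such an `ℓ` exists for every
finite graph when `D > 1`. -/
def radius (G : SimpleGraph V) (D : ℝ) (v : V) : ℕ :=
  sInf {ℓ | ∀ L, ℓ ≤ L → IsLight G D v L}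

/-- The excision of `G` with growth rate `D`: the union over all vertices `v` of the subgraphs
induced by `G` on the balls of radius `radius G D v` around `v`. It is regarded as a graph on all
of `V`. -/
def excision (G : SimpleGraph V) (D : ℝ) : SimpleGraph V where
  Adj u w := G.Adj u w ∧
    ∃ v, u ∈ ballSet G v (radius G D v) ∧ w ∈ ballSet G v (radius G D v)
  symm := ⟨fun _ _ h => ⟨h.1.symm, h.2.imp fun _ hv => ⟨hv.2, hv.1⟩⟩⟩
  loopless := ⟨fun _ h => h.1.ne rfl⟩

open Classical in
/-- The sum of `|C| ^ 2` over the connected components `C` of `H` with more than one vertex. -/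
def sumSqNontrivial [Fintype V] (H : SimpleGraph V) : ℝ :=
  ∑ C : H.ConnectedComponent with 1 < C.supp.ncard, (C.supp.ncard : ℝ) ^ 2

end SBMExcision

end

/-! Write `D = d(1+ε)`, `A = d(1+ε/2)`, `μ = min ε 1`, `Λ = min(ε³, ε)·d = dεμ²`. The proof plants
in every nontrivial component of the excision a witness whose size controls the component, and shows
by a first-moment count that witnesses of size `k` are exponentially rare in `k`. A witness is a
connected set `T` with a subset `S` of density at least `θ = μ/1100` satisfying `|N[S]| > A|S|`
(`IsExpanding`).

Deterministic half. If `v` has radius `L+1 > 0`, its `L`-ball has more than `D^L` vertices, so it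
cannot have grown by a factor of at most `A` at every step from the size `(D/A)^L` on; this yields a
connected `S v` in the ball with `|N[S v]| > A|S v|` (`exists_expanding_subset_ball`,
`exists_local_expanding`). If the component is wide compared with its largest radius `R`, a Vitali
selection produces many such `S v` with disjoint neighbourhoods, joined by paths whose total length
is charged to the selected radii (`exists_skeleton`); the union is again a witness. Balls of radius
`12R` in the component are light, whence `|C| ≤ |T|·D^(12R)` with `R ≤ 2|T|`, so `|C|² ≤ D^(50|T|)`
(`exists_expanding_of_component`).

Probabilistic half. The expected number of connected `k+1`-sets through a vertex is at most
`(4b)^k`, where `b` bounds the expected degrees (`sum_connProb_le`). Given connectivity, the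
independent outside edges of `S` must exceed their mean by a factor of about `1+ε/4`, which costs
`exp(-κ|S|)` with `κ` of order `dεμ`. Since `κθ` is of order `Λ`, it beats the entropy `log(8b)`.
Applying this to ordered disjoint families and dividing by `m!` shows that with high probability at
most `n·exp(-sk)` disjoint witnesses of size `k` exist, for all `k` at once, with `s` of order `Λ`
(`IsSparse`, `edgeMeasure_real_hasDisjointExpanding_le`).

Witnesses in distinct components are disjoint, so the first claim is a geometric sum. For the
second, sparsity forces `s|T| ≤ log n`; when `ε > 1` the bound `(D/A)^(R-1) < |T|+1` makes
components polylogarithmic. -/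

noncomputable section

namespace SBMExcision

/-! ### Connected vertex sets. -/

section Connectivity

variable {V : Type*}

/-- The subgraph of `G` spanned by the edges inside `T`, on the same vertex set. -/
def within (G : SimpleGraph V) (T : Finset V) : SimpleGraph V where
  Adj u w := G.Adj u w ∧ u ∈ T ∧ w ∈ T
  symm := ⟨fun _ _ h => ⟨h.1.symm, h.2.2, h.2.1⟩⟩
  loopless := ⟨fun _ h => h.1.ne rfl⟩

/-- The vertex set `T` is nonempty and induces a connected subgraph of `G`. -/
def IsConn (G : SimpleGraph V) (T : Finset V) : Prop :=
  T.Nonempty ∧ ∀ u ∈ T, ∀ v ∈ T, (within G T).Reachable u v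

lemma within_mono {G G' : SimpleGraph V} {S T : Finset V} (hG : G ≤ G') (hT : S ⊆ T) :
    within G S ≤ within G' T :=
  fun _ _ h => ⟨hG h.1, hT h.2.1, hT h.2.2⟩

lemma within_le {G : SimpleGraph V} {T : Finset V} : within G T ≤ G := fun _ _ h => h.1

lemma IsConn.mono_graph {G G' : SimpleGraph V} {T : Finset V} (hG : G ≤ G') (h : IsConn G T) :
    IsConn G' T :=
  ⟨h.1, fun u hu v hv => (h.2 u hu v hv).mono (within_mono hG le_rfl)⟩

lemma isConn_of_center {G : SimpleGraph V} {T : Finset V} {x : V} (hx : x ∈ T)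
    (h : ∀ u ∈ T, (within G T).Reachable u x) : IsConn G T :=
  ⟨⟨x, hx⟩, fun u hu v hv => (h u hu).trans (h v hv).symm⟩

lemma isConn_singleton (G : SimpleGraph V) (x : V) : IsConn G {x} :=
  isConn_of_center (Finset.mem_singleton_self x) fun u hu => by
    rw [Finset.mem_singleton.1 hu]

variable [DecidableEq V]

lemma IsConn.union {G : SimpleGraph V} {S T : Finset V} (hS : IsConn G S) (hT : IsConn G T)
    {x : V} (hxS : x ∈ S) (hxT : x ∈ T) : IsConn G (S ∪ T) := by
  refine isConn_of_center (Finset.mem_union_left _ hxS) fun u hu => ?_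
  rcases Finset.mem_union.1 hu with hu | hu
  · exact (hS.2 u hu x hxS).mono (within_mono le_rfl Finset.subset_union_left)
  · exact (hT.2 u hu x hxT).mono (within_mono le_rfl Finset.subset_union_right)

lemma isConn_pair {G : SimpleGraph V} {x y : V} (h : G.Adj x y) : IsConn G {x, y} := by
  refine isConn_of_center (x := x) (by simp) fun u hu => ?_
  rcases Finset.mem_insert.1 hu with rfl | hu
  · rfl
  · rw [Finset.mem_singleton.1 hu]
    exact SimpleGraph.Adj.reachable ⟨h.symm, by simp, by simp⟩

lemma IsConn.insert_adj {G : SimpleGraph V} {T : Finset V} (hT : IsConn G T) {x y : V} (hx : x ∈ T)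
    (h : G.Adj x y) : IsConn G (insert y T) := by
  have := hT.union (isConn_pair h) hx (by simp)
  convert this using 1
  ext z
  simp only [Finset.mem_insert, Finset.mem_union, Finset.mem_singleton]
  constructor
  · tauto
  · rintro (h | rfl | h) <;> tauto

lemma isConn_support {G : SimpleGraph V} {u v : V} (p : G.Walk u v) :
    IsConn G p.support.toFinset := by
  induction p with
  | nil => simpa using isConn_singleton G _
  | cons h p ih =>
    rw [SimpleGraph.Walk.support_cons, List.toFinset_cons]
    exact ih.insert_adj (by simp) h.symm

/-- A connected set on at least two vertices splits along an edge at a given vertex `x`. -/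
lemma IsConn.exists_split {G : SimpleGraph V} {T : Finset V} (hT : IsConn G T) {x : V}
    (hx : x ∈ T) (h2 : 2 ≤ T.card) :
    ∃ y, ∃ S ⊆ T, G.Adj x y ∧ y ∈ S ∧ x ∉ S ∧ IsConn G S ∧ IsConn G (T \ S) := by
  classical
  obtain ⟨z, hz, hzx⟩ := Finset.exists_mem_ne (s := T) (by omega) x
  obtain ⟨p⟩ := hT.2 x hx z hz
  obtain ⟨y, hxy⟩ : ∃ y, (within G T).Adj x y := by
    cases p with
    | nil => exact absurd rfl hzx
    | cons h _ => exact ⟨_, h⟩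
  set K := within G (T.erase x) with hK
  have hyx : y ∈ T.erase x := Finset.mem_erase.2 ⟨hxy.1.ne', hxy.2.2⟩
  -- `S` is the component of `y` after deleting `x`. The rest of `T` stays connected because a path
  -- to `x` starting outside `S` cannot enter `S` before reaching `x`.
  set S := T.filter fun u => K.Reachable y u with hS
  have hyS : y ∈ S := Finset.mem_filter.2 ⟨hxy.2.2, SimpleGraph.Reachable.refl _⟩
  have hxS : x ∉ S := by
    intro h
    have hr := (Finset.mem_filter.1 h).2.symm
    obtain ⟨q⟩ := hr
    cases q with
    | nil => exact hxy.1.ne rfl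
    | cons h _ => exact (Finset.mem_erase.1 h.2.1).1 rfl
  refine ⟨y, S, Finset.filter_subset _ _, hxy.1, hyS, hxS, ?_, ?_⟩
  · refine isConn_of_center hyS fun u hu => ?_
    have hr := (Finset.mem_filter.1 hu).2
    refine SimpleGraph.Reachable.symm ?_
    rw [SimpleGraph.reachable_iff_reflTransGen] at hr
    induction hr with
    | refl => rfl
    | @tail b c hb hc ih =>
      have hbr : K.Reachable y b := (SimpleGraph.reachable_iff_reflTransGen _ _).2 hb
      have hbS : b ∈ S :=
        Finset.mem_filter.2 ⟨(Finset.mem_erase.1 hc.2.1).2, hbr⟩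
      have hcb : (within G S).Adj b c := ⟨hc.1, hbS, hu⟩
      exact (ih hbS).trans hcb.reachable
  · have hxT : x ∈ T \ S := Finset.mem_sdiff.2 ⟨hx, hxS⟩
    refine isConn_of_center hxT fun u hu => ?_
    have hr := hT.2 u (Finset.mem_sdiff.1 hu).1 x hx
    rw [SimpleGraph.reachable_iff_reflTransGen] at hr
    induction hr using Relation.ReflTransGen.head_induction_on with
    | refl => rfl
    | @head a c hac hc ih =>
      by_cases hax : a = x
      · rw [hax]
      by_cases hcS : c ∈ S
      · exfalso
        have hcx : c ≠ x := fun h => hxS (h ▸ hcS)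
        have : K.Adj c a := ⟨hac.1.symm, Finset.mem_erase.2 ⟨hcx, hac.2.2⟩,
          Finset.mem_erase.2 ⟨hax, hac.2.1⟩⟩
        exact (Finset.mem_sdiff.1 hu).2 (Finset.mem_filter.2 ⟨hac.2.1,
          (Finset.mem_filter.1 hcS).2.trans this.reachable⟩)
      · have hcT : c ∈ T \ S := Finset.mem_sdiff.2 ⟨hac.2.2, hcS⟩
        have had : (within G (T \ S)).Adj a c := ⟨hac.1, hu, hcT⟩
        exact had.reachable.trans (ih hcT)

end Connectivity

/-! ### Independent edges and the expected number of connected sets. -/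

section EdgeMeasure

variable {n : ℕ}

/-- The product measure under which the pair `e` is present with probability `p e`. -/
abbrev edgeMeasure (p : Sym2 (Fin n) → unitInterval) : Measure (Sym2 (Fin n) → Bool) :=
  Measure.pi fun e => coin (p e)

lemma coin_real_true (p : unitInterval) : (coin p).real {true} = p := by
  simp [coin, measureReal_def, ENNReal.toReal_ofReal p.2.1]

lemma integral_coin (p : unitInterval) (f : Bool → ℝ) :
    ∫ x, f x ∂coin p = p * f true + (1 - p) * f false := by
  rw [integral_fintype .of_finite]
  have hf : (coin p).real {false} = 1 - p := by
    simp [coin, measureReal_def, ENNReal.toReal_ofReal (sub_nonneg.2 p.2.2)]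
  simp [coin_real_true, hf]

lemma edgeMeasure_real_eval (p : Sym2 (Fin n) → unitInterval) (e : Sym2 (Fin n)) :
    (edgeMeasure p).real {ω | ω e = true} = p e := by
  have h := (measurePreserving_eval (fun e => coin (p e)) e).measureReal_preimage
    (s := {true}) (MeasurableSet.of_discrete.nullMeasurableSet)
  rw [coin_real_true] at h
  exact h

lemma edgeMeasure_real_inter (p : Sym2 (Fin n) → unitInterval)
    {A B : Set (Sym2 (Fin n) → Bool)} {I J : Set (Sym2 (Fin n))} (hIJ : Disjoint I J)
    (hA : DependsOn (· ∈ A) I) (hB : DependsOn (· ∈ B) J) :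
    (edgeMeasure p).real (A ∩ B) = (edgeMeasure p).real A * (edgeMeasure p).real B := by
  classical
  have hind := ProbabilityTheory.iIndepFun_pi (μ := fun e => coin (p e))
    (X := fun _ => id) (fun _ => aemeasurable_id)
  have hfin := hind.indepFun_finset I.toFinset J.toFinset
    (by rwa [Set.disjoint_toFinset]) (fun i => measurable_pi_apply i)
  -- An event depending only on the coordinates in `I` is the preimage of its image under
  -- restriction to `I`, which is the form that independence of restrictions can use.
  have key : ∀ {A : Set (Sym2 (Fin n) → Bool)} {I : Set (Sym2 (Fin n))},
      DependsOn (· ∈ A) I → A = (fun a (i : I.toFinset) => id (a i)) ⁻¹'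
        ((fun (a : Sym2 (Fin n) → Bool) (i : I.toFinset) => id (a i)) '' A) := by
    intro A I h
    refine Set.Subset.antisymm (Set.subset_preimage_image _ _) ?_
    rintro a ⟨b, hb, hab⟩
    have := h (x := b) (y := a) fun i hi => congrFun hab ⟨i, by simpa using hi⟩
    exact this.mp hb
  have h := hfin.measure_inter_preimage_eq_mul _ _
    (Set.toFinite ((fun (a : Sym2 (Fin n) → Bool) (i : I.toFinset) => id (a i)) '' A)).measurableSet
    (Set.toFinite ((fun (a : Sym2 (Fin n) → Bool) (i : J.toFinset) => id (a i)) '' B)).measurableSet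
  rw [← key hA, ← key hB] at h
  simp only [measureReal_def, h, ENNReal.toReal_mul]

lemma edgeMeasure_real_biInter {ι : Type*} [DecidableEq ι] (p : Sym2 (Fin n) → unitInterval)
    (s : Finset ι)
    {A : ι → Set (Sym2 (Fin n) → Bool)} {B : Set (Sym2 (Fin n) → Bool)}
    {I : ι → Set (Sym2 (Fin n))} {J : Set (Sym2 (Fin n))}
    (hI : (s : Set ι).PairwiseDisjoint I) (hIJ : ∀ i ∈ s, Disjoint (I i) J)
    (hA : ∀ i ∈ s, DependsOn (· ∈ A i) (I i)) (hB : DependsOn (· ∈ B) J) :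
    (edgeMeasure p).real ((⋂ i ∈ s, A i) ∩ B) =
      (∏ i ∈ s, (edgeMeasure p).real (A i)) * (edgeMeasure p).real B := by
  induction s using Finset.induction_on with
  | empty => simp
  | @insert a s has ih =>
    rw [Finset.set_biInter_insert, Set.inter_assoc, Finset.prod_insert has, mul_assoc, ← ih]
    · refine edgeMeasure_real_inter p (I := I a) (J := (⋃ i ∈ s, I i) ∪ J) ?_
        (hA a (by simp)) ?_
      · rw [Set.disjoint_union_right, Set.disjoint_iUnion₂_right]
        refine ⟨fun i hi => hI (by simp) (by simp [hi]) ?_, hIJ a (by simp)⟩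
        rintro rfl
        exact has hi
      · intro x y h
        have h1 : x ∈ B ↔ y ∈ B := iff_of_eq (hB fun i hi => h i (Or.inr hi))
        have h2 : ∀ i ∈ s, (x ∈ A i ↔ y ∈ A i) := fun i hi =>
          iff_of_eq (hA i (by simp [hi]) fun e he =>
            h e (Or.inl (Set.mem_iUnion₂.2 ⟨i, hi, he⟩)))
        simp only [Set.mem_inter_iff, Set.mem_iInter, eq_iff_iff]
        rw [h1]
        exact and_congr_left fun _ => forall₂_congr h2
    · exact hI.subset (by simp)
    · exact fun i hi => hIJ i (by simp [hi])
    · exact fun i hi => hA i (by simp [hi])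

/-- The pairs inside the vertex set `T`. -/
def inner (T : Finset (Fin n)) : Set (Sym2 (Fin n)) := {e | ∀ u ∈ e, u ∈ T}

lemma disjoint_inner {S T : Finset (Fin n)} (h : Disjoint S T) : Disjoint (inner S) (inner T) := by
  rw [Set.disjoint_left]
  intro e hS hT
  induction e with
  | _ u v =>
    exact Finset.disjoint_left.1 h (hS u (by simp)) (hT u (by simp))

lemma adj_graphOf {ω : Sym2 (Fin n) → Bool} {u v : Fin n} :
    (graphOf ω).Adj u v ↔ ω s(u, v) = true ∧ u ≠ v := by
  simp [graphOf]

lemma dependsOn_isConn (T : Finset (Fin n)) :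
    DependsOn (· ∈ {ω : Sym2 (Fin n) → Bool | IsConn (graphOf ω) T}) (inner T) := by
  intro x y h
  have : within (graphOf x) T = within (graphOf y) T := by
    ext u v
    simp only [within, adj_graphOf]
    constructor
    · rintro ⟨⟨h1, h2⟩, hu, hv⟩
      exact ⟨⟨by rw [← h1, h]; rintro w hw; rcases Sym2.mem_iff.1 hw with rfl | rfl <;> assumption,
        h2⟩, hu, hv⟩
    · rintro ⟨⟨h1, h2⟩, hu, hv⟩
      exact ⟨⟨by rw [← h1, h]; rintro w hw; rcases Sym2.mem_iff.1 hw with rfl | rfl <;> assumption,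
        h2⟩, hu, hv⟩
  simp only [Set.mem_ofPred_eq, IsConn, this]

/-- The probability that `T` is connected. -/
def connProb (p : Sym2 (Fin n) → unitInterval) (T : Finset (Fin n)) : ℝ :=
  (edgeMeasure p).real {ω | IsConn (graphOf ω) T}

lemma connProb_nonneg (p : Sym2 (Fin n) → unitInterval) (T : Finset (Fin n)) :
    0 ≤ connProb p T := measureReal_nonneg

lemma connProb_le_one (p : Sym2 (Fin n) → unitInterval) (T : Finset (Fin n)) :
    connProb p T ≤ 1 := measureReal_le_one

/-- A connected set is cut by `IsConn.exists_split` at an edge `xy` into two disjoint connected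
pieces. The edge and the insides of the two pieces are disjoint sets of pairs, so their
probabilities multiply. -/
lemma connProb_le_sum (p : Sym2 (Fin n) → unitInterval) {T : Finset (Fin n)} {x : Fin n}
    (hx : x ∈ T) (h2 : 2 ≤ T.card) :
    connProb p T ≤ ∑ i : Fin n × Finset (Fin n) × Finset (Fin n) with
        (x ∈ i.2.1 ∧ i.1 ∈ i.2.2) ∧ Disjoint i.2.1 i.2.2 ∧ i.2.1 ∪ i.2.2 = T,
      (p s(x, i.1) : ℝ) * (connProb p i.2.1 * connProb p i.2.2) := by
  set F := (Finset.univ : Finset (Fin n × Finset (Fin n) × Finset (Fin n))).filter fun i =>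
    (x ∈ i.2.1 ∧ i.1 ∈ i.2.2) ∧ Disjoint i.2.1 i.2.2 ∧ i.2.1 ∪ i.2.2 = T with hF
  let E : Fin n × Finset (Fin n) × Finset (Fin n) → Set (Sym2 (Fin n) → Bool) := fun i =>
    {ω | ω s(x, i.1) = true} ∩
      ({ω | IsConn (graphOf ω) i.2.1} ∩ {ω | IsConn (graphOf ω) i.2.2})
  have hsub : {ω | IsConn (graphOf ω) T} ⊆ ⋃ i ∈ F, E i := by
    intro ω hω
    obtain ⟨y, S, hST, hxy, hyS, hxS, hS, hTS⟩ := IsConn.exists_split hω hx h2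
    refine Set.mem_iUnion₂.2 ⟨(y, T \ S, S), ?_, (adj_graphOf.1 hxy).1, hTS, hS⟩
    simp [hF, hx, hxS, hyS, Finset.sdiff_union_of_subset hST, Finset.sdiff_disjoint]
  refine (measureReal_mono hsub (measure_ne_top _ _)).trans
    ((measureReal_biUnion_finset_le _ _).trans ?_)
  refine Finset.sum_le_sum fun i hi => le_of_eq ?_
  obtain ⟨⟨h1, h2⟩, h3, h4⟩ := (Finset.mem_filter.1 hi).2
  have hd := disjoint_inner h3
  have e1 := edgeMeasure_real_inter p hd (dependsOn_isConn i.2.1) (dependsOn_isConn i.2.2)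
  have e2 : (edgeMeasure p).real (E i) = _ :=
    edgeMeasure_real_inter p (A := {ω | ω s(x, i.1) = true})
      (B := {ω | IsConn (graphOf ω) i.2.1} ∩ {ω | IsConn (graphOf ω) i.2.2})
      (I := {s(x, i.1)}) (J := inner i.2.1 ∪ inner i.2.2) ?_ ?_ ?_
  · rw [e2, e1, edgeMeasure_real_eval]
    rfl
  · rw [Set.disjoint_singleton_left]
    rintro (h | h)
    · exact Finset.disjoint_left.1 h3 (h i.1 (by simp)) h2
    · exact Finset.disjoint_left.1 h3 h1 (h x (by simp))
  · intro a b h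
    simp only [Set.mem_ofPred_eq, h _ (Set.mem_singleton _)]
  · intro a b h
    simp only [Set.mem_inter_iff]
    have h5 := dependsOn_isConn i.2.1 fun e he => h e (Or.inl he)
    have h6 := dependsOn_isConn i.2.2 fun e he => h e (Or.inr he)
    exact congrArg₂ And h5 h6

/-- The sets of `k` vertices containing `x`. -/
def rootedSets (x : Fin n) (k : ℕ) : Finset (Finset (Fin n)) :=
  Finset.univ.filter fun T => x ∈ T ∧ T.card = k

/-- Summing the splitting inequality over all `T` turns it into the Catalan recursion, with one
factor `b` for the choice of `y`. -/
lemma sum_connProb_le_catalan (p : Sym2 (Fin n) → unitInterval) {b : ℝ}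
    (hb : ∀ v, ∑ w, (p s(v, w) : ℝ) ≤ b) (k : ℕ) (x : Fin n) :
    ∑ T ∈ rootedSets x (k + 1), connProb p T ≤ catalan k * b ^ k := by
  induction k using Nat.strong_induction_on generalizing x with
  | _ k ih =>
  have hb0 : 0 ≤ b := (Finset.sum_nonneg fun w _ => (p s(x, w)).2.1).trans (hb x)
  rcases k with _ | k
  · have : rootedSets x 1 = {{x}} := by
      ext T
      simp only [rootedSets, Finset.mem_filter, Finset.mem_univ, true_and, Finset.mem_singleton]
      constructor
      · rintro ⟨hx, hc⟩
        obtain ⟨y, rfl⟩ := Finset.card_eq_one.1 hc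
        rw [Finset.mem_singleton.1 hx]
      · rintro rfl
        simp
    simp only [zero_add, this, Finset.sum_singleton, catalan_zero, Nat.cast_one, pow_zero, mul_one]
    exact connProb_le_one p _
  · set g : Fin n × Finset (Fin n) × Finset (Fin n) → ℝ := fun i =>
      (p s(x, i.1) : ℝ) * (connProb p i.2.1 * connProb p i.2.2) with hg
    have hg0 : ∀ i, 0 ≤ g i := fun i =>
      mul_nonneg (p _).2.1 (mul_nonneg (connProb_nonneg p _) (connProb_nonneg p _))
    calc ∑ T ∈ rootedSets x (k + 1 + 1), connProb p T
        ≤ ∑ T ∈ rootedSets x (k + 1 + 1),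
          ∑ i : Fin n × Finset (Fin n) × Finset (Fin n) with
            (x ∈ i.2.1 ∧ i.1 ∈ i.2.2) ∧ Disjoint i.2.1 i.2.2 ∧ i.2.1 ∪ i.2.2 = T, g i := by
          refine Finset.sum_le_sum fun T hT => ?_
          obtain ⟨hx, hc⟩ := (Finset.mem_filter.1 hT).2
          exact connProb_le_sum p hx (by omega)
      _ = ∑ i : Fin n × Finset (Fin n) × Finset (Fin n) with
            ((x ∈ i.2.1 ∧ i.1 ∈ i.2.2) ∧ Disjoint i.2.1 i.2.2) ∧
              (i.2.1 ∪ i.2.2).card = k + 2,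
          ∑ T ∈ ({i.2.1 ∪ i.2.2} : Finset (Finset (Fin n))), g i := by
          refine Finset.sum_comm' fun T i => ?_
          simp only [rootedSets, Finset.mem_filter, Finset.mem_univ, true_and,
            Finset.mem_singleton]
          constructor
          · rintro ⟨⟨h1, h2⟩, ⟨h3, h4⟩, h5, rfl⟩
            exact ⟨rfl, ⟨⟨h3, h4⟩, h5⟩, h2⟩
          · rintro ⟨rfl, ⟨⟨h3, h4⟩, h5⟩, h2⟩
            exact ⟨⟨Finset.mem_union_left _ h3, h2⟩, ⟨h3, h4⟩, h5, rfl⟩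
      -- Dropping the disjointness of the pieces decouples the sums over `T₁` and `T₂`. The sizes
      -- are `i+1` and `j+1` with `i+j = k`, since each piece contains its root.
      _ ≤ ∑ y, ∑ T₁, ∑ T₂, ∑ ij ∈ Finset.HasAntidiagonal.antidiagonal k,
          if T₁ ∈ rootedSets x (ij.1 + 1) ∧ T₂ ∈ rootedSets y (ij.2 + 1) then g (y, T₁, T₂)
          else 0 := by
          simp only [Finset.sum_singleton]
          rw [← Fintype.sum_prod_type', ← Fintype.sum_prod_type']
          rw [← (Equiv.prodAssoc _ _ _).symm.sum_comp]
          rw [Finset.sum_filter]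
          refine Finset.sum_le_sum fun i _ => ?_
          split_ifs with h
          · obtain ⟨⟨⟨h1, h2⟩, h3⟩, h4⟩ := h
            rw [Finset.card_union_of_disjoint h3] at h4
            have c1 : 0 < i.2.1.card := Finset.card_pos.2 ⟨_, h1⟩
            have c2 : 0 < i.2.2.card := Finset.card_pos.2 ⟨_, h2⟩
            have hmem : (i.2.1.card - 1, i.2.2.card - 1) ∈ Finset.HasAntidiagonal.antidiagonal k := by
              rw [Finset.HasAntidiagonal.mem_antidiagonal]; simp only; omega
            refine le_trans (le_of_eq ?_) (Finset.single_le_sum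
              (f := fun ij : ℕ × ℕ => if i.2.1 ∈ rootedSets x (ij.1 + 1) ∧
                i.2.2 ∈ rootedSets i.1 (ij.2 + 1) then g (i.1, i.2.1, i.2.2) else 0)
              (fun ij _ => ?_) hmem)
            · rw [if_pos]
              simp only [rootedSets, Finset.mem_filter, Finset.mem_univ, true_and]
              exact ⟨⟨h1, by omega⟩, h2, by omega⟩
            · split_ifs
              exacts [hg0 _, le_rfl]
          · refine Finset.sum_nonneg fun ij _ => ?_
            split_ifs
            exacts [hg0 _, le_rfl]
      _ = ∑ y, ∑ ij ∈ Finset.HasAntidiagonal.antidiagonal k, (p s(x, y) : ℝ) *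
          ((∑ T ∈ rootedSets x (ij.1 + 1), connProb p T) *
            ∑ T ∈ rootedSets y (ij.2 + 1), connProb p T) := by
          refine Finset.sum_congr rfl fun y _ => ?_
          simp_rw [Finset.sum_comm (t := Finset.HasAntidiagonal.antidiagonal k)]
          refine Finset.sum_congr rfl fun ij _ => ?_
          rw [Finset.sum_mul_sum, Finset.mul_sum]
          simp_rw [Finset.mul_sum]
          rw [rootedSets, Finset.sum_filter]
          refine Finset.sum_congr rfl fun T₁ _ => ?_
          by_cases h : x ∈ T₁ ∧ T₁.card = ij.1 + 1
          · rw [if_pos h, rootedSets, Finset.sum_filter]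
            refine Finset.sum_congr rfl fun T₂ _ => ?_
            simp [h, hg]
          · rw [if_neg h]
            refine Finset.sum_eq_zero fun T₂ _ => if_neg fun h' => h ?_
            simpa using h'.1
      _ ≤ ∑ y, ∑ ij ∈ Finset.HasAntidiagonal.antidiagonal k, (p s(x, y) : ℝ) *
          (((catalan ij.1 : ℝ) * b ^ ij.1) * ((catalan ij.2 : ℝ) * b ^ ij.2)) := by
          refine Finset.sum_le_sum fun y _ => Finset.sum_le_sum fun ij hij => ?_
          rw [Finset.HasAntidiagonal.mem_antidiagonal] at hij
          refine mul_le_mul_of_nonneg_left ?_ (p _).2.1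
          exact mul_le_mul (ih _ (by omega) _) (ih _ (by omega) _)
            (Finset.sum_nonneg fun _ _ => connProb_nonneg p _) (by positivity)
      _ = (∑ y, (p s(x, y) : ℝ)) * (catalan (k + 1) * b ^ k) := by
          rw [Finset.sum_mul]
          refine Finset.sum_congr rfl fun y _ => ?_
          rw [catalan_succ', ← Finset.mul_sum]
          push_cast
          rw [Finset.sum_mul]
          congr 1
          refine Finset.sum_congr rfl fun ij hij => ?_
          rw [← Finset.HasAntidiagonal.mem_antidiagonal.1 hij, pow_add]
          ring
      _ ≤ b * (catalan (k + 1) * b ^ k) := by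
          exact mul_le_mul_of_nonneg_right (hb x) (by positivity)
      _ = catalan (k + 1) * b ^ (k + 1) := by ring

lemma catalan_le_four_pow (k : ℕ) : catalan k ≤ 4 ^ k := by
  rw [catalan_eq_centralBinom_div]
  refine (Nat.div_le_self _ _).trans ?_
  rw [Nat.centralBinom_eq_two_mul_choose]
  calc (2 * k).choose k ≤ ∑ m ∈ Finset.range (2 * k + 1), (2 * k).choose m :=
        Finset.single_le_sum (f := fun m => (2 * k).choose m) (fun _ _ => Nat.zero_le _)
          (Finset.mem_range.2 (by omega))
    _ = 2 ^ (2 * k) := Nat.sum_range_choose _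
    _ = 4 ^ k := by rw [pow_mul]; norm_num

lemma sum_connProb_le (p : Sym2 (Fin n) → unitInterval) {b : ℝ}
    (hb : ∀ v, ∑ w, (p s(v, w) : ℝ) ≤ b) (k : ℕ) (x : Fin n) :
    ∑ T ∈ rootedSets x (k + 1), connProb p T ≤ (4 * b) ^ k := by
  have hb0 : 0 ≤ b := (Finset.sum_nonneg fun w _ => (p s(x, w)).2.1).trans (hb x)
  refine (sum_connProb_le_catalan p hb k x).trans ?_
  rw [mul_pow]
  gcongr
  exact_mod_cast catalan_le_four_pow k

end EdgeMeasure

/-! ### Expanding sets, the witnesses of the argument. -/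

section Expanding

variable {V : Type*} [Fintype V]

open Classical in
/-- The vertices of `S` together with their neighbours. -/
def closedNbhd (G : SimpleGraph V) (S : Finset V) : Finset V :=
  Finset.univ.filter fun w => w ∈ S ∨ ∃ u ∈ S, G.Adj u w

lemma mem_closedNbhd {G : SimpleGraph V} {S : Finset V} {w : V} :
    w ∈ closedNbhd G S ↔ w ∈ S ∨ ∃ u ∈ S, G.Adj u w := by
  simp [closedNbhd]

/-- `T` is connected and has a subset of density at least `θ` whose closed neighbourhood is more
than `A` times as large as the subset itself. -/
def IsExpanding (G : SimpleGraph V) (θ A : ℝ) (T : Finset V) : Prop :=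
  IsConn G T ∧ ∃ S ⊆ T, θ * T.card ≤ S.card ∧ A * S.card < (closedNbhd G S).card

end Expanding

/-! ### Chernoff and union bounds for disjoint families of expanding sets. -/

section UnionBound

variable {n : ℕ}

/-- The pairs of `P` whose underlying edge is present in `ω`. -/
def openPairs (P : Finset (Fin n × Fin n)) (ω : Sym2 (Fin n) → Bool) : Finset (Fin n × Fin n) :=
  P.filter fun q => ω s(q.1, q.2) = true

/-- Convexity in `c`: the chord over `[0, 2]` lies above the exponential. -/
lemma exp_mul_sub_one_le {t : ℝ} {c : ℕ} (hc : c ≤ 2) :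
    Real.exp (t * c) - 1 ≤ c * ((Real.exp (2 * t) - 1) / 2) := by
  have h : Real.exp (2 * t) = Real.exp t ^ 2 := by rw [← Real.exp_nat_mul]; norm_num
  interval_cases c
  · simp
  · rw [h]
    push_cast
    rw [mul_one]
    nlinarith [sq_nonneg (Real.exp t - 1)]
  · push_cast
    rw [mul_comm t 2]
    linarith

lemma card_fiber_le_two (P : Finset (Fin n × Fin n)) (e : Sym2 (Fin n)) :
    (P.filter fun q => s(q.1, q.2) = e).card ≤ 2 := by
  induction e with
  | _ u v =>
    refine (Finset.card_le_card (t := {(u, v), (v, u)}) ?_).trans Finset.card_le_two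
    intro q hq
    have := (Finset.mem_filter.1 hq).2
    rw [Sym2.eq_iff] at this
    simp only [Finset.mem_insert, Finset.mem_singleton, Prod.ext_iff]
    exact this

/-- Ordered pairs are counted, so one edge may contribute twice, as `(u, v)` and `(v, u)`. The
Poisson-type bound survives with `exp t - 1` replaced by `(exp (2t) - 1)/2`. -/
lemma mgf_openPairs_le (p : Sym2 (Fin n) → unitInterval) (P : Finset (Fin n × Fin n)) (t : ℝ) :
    ProbabilityTheory.mgf (fun ω => ((openPairs P ω).card : ℝ)) (edgeMeasure p) t ≤
      Real.exp ((Real.exp (2 * t) - 1) / 2 * ∑ q ∈ P, (p s(q.1, q.2) : ℝ)) := by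
  set c : Sym2 (Fin n) → ℕ := fun e => (P.filter fun q => s(q.1, q.2) = e).card with hc
  have h1 : ∀ ω : Sym2 (Fin n) → Bool, Real.exp (t * ((openPairs P ω).card : ℝ)) =
      ∏ e, (if ω e = true then Real.exp (t * c e) else 1) := by
    intro ω
    rw [openPairs, Finset.card_filter]
    push_cast
    rw [Finset.mul_sum, Real.exp_sum,
      ← Finset.prod_fiberwise P (fun q : Fin n × Fin n => s(q.1, q.2))]
    refine Finset.prod_congr rfl fun e _ => ?_
    rw [Finset.prod_congr rfl (g := fun _ => if ω e = true then Real.exp t else 1)]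
    · rw [Finset.prod_const]
      split_ifs
      · rw [← Real.exp_nat_mul, mul_comm]
      · simp
    · intro q hq
      rw [(Finset.mem_filter.1 hq).2]
      split_ifs <;> simp
  have h2 : ∑ q ∈ P, (p s(q.1, q.2) : ℝ) = ∑ e, c e * (p e : ℝ) := by
    rw [← Finset.sum_fiberwise P (fun q : Fin n × Fin n => s(q.1, q.2))]
    refine Finset.sum_congr rfl fun e _ => ?_
    rw [Finset.sum_congr rfl (g := fun _ => (p e : ℝ))]
    · rw [Finset.sum_const, nsmul_eq_mul]
    · intro q hq
      rw [(Finset.mem_filter.1 hq).2]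
  rw [ProbabilityTheory.mgf, integral_congr_ae (ae_of_all _ h1),
    integral_fintype_prod_eq_prod (fun e (x : Bool) => if x = true then Real.exp (t * c e) else 1),
    h2, Finset.mul_sum, Real.exp_sum]
  refine Finset.prod_le_prod (fun e _ => ?_) fun e _ => ?_
  · exact integral_nonneg fun x => by dsimp only; split_ifs <;> positivity
  · rw [integral_coin]
    have := exp_mul_sub_one_le (t := t) (card_fiber_le_two P e)
    have h3 := mul_le_mul_of_nonneg_left this (p e).2.1
    have h4 := Real.add_one_le_exp ((Real.exp (2 * t) - 1) / 2 * ((c e : ℝ) * (p e : ℝ)))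
    simp only [if_true, Bool.false_eq_true, if_false]
    simp only [hc] at h3 h4 ⊢
    linarith

lemma edgeMeasure_real_openPairs_le (p : Sym2 (Fin n) → unitInterval)
    (P : Finset (Fin n × Fin n)) {t a b κ N : ℝ} (ht : 0 ≤ t) (hN : 0 ≤ N)
    (hP : ∑ q ∈ P, (p s(q.1, q.2) : ℝ) ≤ b * N)
    (hκ : (Real.exp (2 * t) - 1) / 2 * b - t * a ≤ -κ) :
    (edgeMeasure p).real {ω | a * N ≤ (openPairs P ω).card} ≤ Real.exp (-κ * N) := by
  refine (ProbabilityTheory.measure_ge_le_exp_mul_mgf (μ := edgeMeasure p)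
    (X := fun ω => ((openPairs P ω).card : ℝ)) (a * N) ht .of_finite).trans ?_
  refine (mul_le_mul_of_nonneg_left (mgf_openPairs_le p P t) (Real.exp_pos _).le).trans ?_
  rw [← Real.exp_add]
  refine Real.exp_le_exp.2 ?_
  have h1 : 0 ≤ (Real.exp (2 * t) - 1) / 2 := by
    have := Real.one_le_exp (x := 2 * t) (by positivity)
    linarith
  have h2 := mul_le_mul_of_nonneg_left hP h1
  have h3 := mul_le_mul_of_nonneg_right hκ hN
  nlinarith

lemma card_closedNbhd_le {ω : Sym2 (Fin n) → Bool} {S T : Finset (Fin n)} (hST : S ⊆ T) :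
    (closedNbhd (graphOf ω) S).card ≤ T.card + (openPairs (S ×ˢ Tᶜ) ω).card := by
  have : closedNbhd (graphOf ω) S ⊆ T ∪ (openPairs (S ×ˢ Tᶜ) ω).image Prod.snd := by
    intro w hw
    by_cases hwT : w ∈ T
    · exact Finset.mem_union_left _ hwT
    · rcases mem_closedNbhd.1 hw with h | ⟨u, hu, huw⟩
      · exact absurd (hST h) hwT
      · refine Finset.mem_union_right _ (Finset.mem_image.2 ⟨(u, w), ?_, rfl⟩)
        simp [openPairs, hu, hwT, (adj_graphOf.1 huw).1]
  refine (Finset.card_le_card this).trans ((Finset.card_union_le _ _).trans ?_)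
  gcongr
  exact Finset.card_image_le

/-- The edges inside the sets `(f i).1` are independent of those leaving the `(f i).2`. The outgoing
counts for different `i` are not mutually independent, since an edge between two of the subsets
serves both; only their sum is bounded, and its Chernoff estimate factors over `i`. -/
lemma edgeMeasure_real_family_le (p : Sym2 (Fin n) → unitInterval) {b : ℝ}
    (hb : ∀ v, ∑ w, (p s(v, w) : ℝ) ≤ b) {t a κ : ℝ} (ht : 0 ≤ t)
    (hκ : (Real.exp (2 * t) - 1) / 2 * b - t * a ≤ -κ) {m : ℕ}
    (f : Fin m → Finset (Fin n) × Finset (Fin n))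
    (hd : Pairwise fun i j => Disjoint (f i).1 (f j).1) (hf : ∀ i, (f i).2 ⊆ (f i).1) :
    (edgeMeasure p).real {ω | ∀ i, IsConn (graphOf ω) (f i).1 ∧
        ((f i).1.card : ℝ) + a * (f i).2.card ≤ (closedNbhd (graphOf ω) (f i).2).card} ≤
      ∏ i, connProb p (f i).1 * Real.exp (-κ * (f i).2.card) := by
  set P : Finset (Fin n × Fin n) := Finset.univ.biUnion fun i => (f i).2 ×ˢ ((f i).1)ᶜ with hP
  set N : ℝ := ∑ i, ((f i).2.card : ℝ) with hN
  have hpd : ∀ i ∈ (Finset.univ : Finset (Fin m)), ∀ j ∈ (Finset.univ : Finset (Fin m)), i ≠ j →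
      Disjoint ((f i).2 ×ˢ ((f i).1)ᶜ) ((f j).2 ×ˢ ((f j).1)ᶜ) := by
    intro i _ j _ hij
    rw [Finset.disjoint_product]
    exact Or.inl (Finset.disjoint_of_subset_left (hf i)
      (Finset.disjoint_of_subset_right (hf j) (hd hij)))
  have hsum : ∑ q ∈ P, (p s(q.1, q.2) : ℝ) ≤ b * N := by
    rw [hP, Finset.sum_biUnion hpd, hN, Finset.mul_sum]
    refine Finset.sum_le_sum fun i _ => ?_
    rw [Finset.sum_product, mul_comm, ← nsmul_eq_mul]
    refine Finset.sum_le_card_nsmul _ _ _ fun u _ => ?_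
    refine le_trans ?_ (hb u)
    exact Finset.sum_le_univ_sum_of_nonneg fun w => (p _).2.1
  have hN0 : 0 ≤ N := Finset.sum_nonneg fun i _ => Nat.cast_nonneg _
  have hsub : {ω | ∀ i, IsConn (graphOf ω) (f i).1 ∧
        ((f i).1.card : ℝ) + a * (f i).2.card ≤ (closedNbhd (graphOf ω) (f i).2).card} ⊆
      (⋂ i ∈ (Finset.univ : Finset (Fin m)), {ω | IsConn (graphOf ω) (f i).1}) ∩
        {ω | a * N ≤ (openPairs P ω).card} := by
    intro ω hω
    refine ⟨Set.mem_iInter₂.2 fun i _ => (hω i).1, ?_⟩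
    have h1 : (openPairs P ω).card = ∑ i, (openPairs ((f i).2 ×ˢ ((f i).1)ᶜ) ω).card := by
      rw [openPairs, hP, Finset.filter_biUnion, Finset.card_biUnion]
      · rfl
      · intro i hi j hj hij
        exact Finset.disjoint_filter_filter (hpd i hi j hj hij)
    show a * N ≤ _
    rw [h1, hN, Finset.mul_sum]
    push_cast
    refine Finset.sum_le_sum fun i _ => ?_
    have h2 := (hω i).2
    have h3 : ((closedNbhd (graphOf ω) (f i).2).card : ℝ) ≤
        (f i).1.card + (openPairs ((f i).2 ×ˢ ((f i).1)ᶜ) ω).card := by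
      exact_mod_cast card_closedNbhd_le (hf i)
    linarith
  refine (measureReal_mono hsub).trans ?_
  rw [edgeMeasure_real_biInter p Finset.univ (I := fun i => inner (f i).1)
    (J := {e | ∃ q ∈ P, s(q.1, q.2) = e})
    (fun i _ j _ hij => disjoint_inner (hd hij)) ?_ (fun i _ => dependsOn_isConn _) ?_,
    Finset.prod_mul_distrib]
  · refine mul_le_mul_of_nonneg_left ?_ (Finset.prod_nonneg fun i _ => connProb_nonneg p _)
    rw [← Real.exp_sum, ← Finset.mul_sum]
    exact edgeMeasure_real_openPairs_le p P ht hN0 hsum hκ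
  · intro i _
    rw [Set.disjoint_left]
    rintro e he ⟨q, hq, rfl⟩
    obtain ⟨j, -, hj⟩ := Finset.mem_biUnion.1 hq
    obtain ⟨h1, h2⟩ := Finset.mem_product.1 hj
    have h3 := he q.1 (by simp)
    have h4 := he q.2 (by simp)
    by_cases hij : i = j
    · subst hij
      exact Finset.mem_compl.1 h2 h4
    · exact Finset.disjoint_left.1 (hd hij) h3 (hf j h1)
  · intro x y h
    have : openPairs P x = openPairs P y :=
      Finset.filter_congr fun q hq => by rw [h _ ⟨q, hq, rfl⟩]
    simp only [Set.mem_ofPred_eq, this]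

/-- A union bound with multiplicity, proved by integrating the number of events that occur. With `M
= m!` it gains the factor `1/m!` from reordering a family of `m` sets. -/
lemma mul_measureReal_le_sum_of_card_le {Ω ι : Type*} [Finite Ω] [MeasurableSpace Ω]
    [MeasurableSingletonClass Ω] (μ : Measure Ω) [IsFiniteMeasure μ] (F : Finset ι)
    (A : ι → Set Ω) (E : Set Ω) (M : ℕ) (s : Ω → Finset ι) (hs : ∀ ω ∈ E, s ω ⊆ F)
    (hA : ∀ ω ∈ E, ∀ i ∈ s ω, ω ∈ A i) (hM : ∀ ω ∈ E, M ≤ (s ω).card) :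
    M * μ.real E ≤ ∑ i ∈ F, μ.real (A i) := by
  classical
  have hm : ∀ B : Set Ω, MeasurableSet B := fun B => (Set.toFinite B).measurableSet
  have h1 : ∀ B : Set Ω, μ.real B = ∫ ω, B.indicator (fun _ => (1 : ℝ)) ω ∂μ := fun B => by
    rw [integral_indicator (hm B)]; simp
  rw [h1, Finset.sum_congr rfl fun i _ => h1 (A i), ← integral_const_mul,
    ← integral_finsetSum _ fun i _ => .of_finite]
  refine integral_mono .of_finite .of_finite fun ω => ?_
  dsimp only
  have h0 : ∀ i, 0 ≤ (A i).indicator (fun _ => (1 : ℝ)) ω := fun i =>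
    Set.indicator_nonneg (fun _ _ => zero_le_one) _
  by_cases hω : ω ∈ E
  · rw [Set.indicator_of_mem hω, mul_one]
    calc (M : ℝ) ≤ (s ω).card := by exact_mod_cast hM ω hω
      _ = ∑ i ∈ s ω, (A i).indicator (fun _ => (1 : ℝ)) ω := by
        rw [Finset.sum_congr rfl fun i hi => Set.indicator_of_mem (hA ω hω i hi) _]
        simp
      _ ≤ _ := Finset.sum_le_sum_of_subset_of_nonneg (hs ω hω) fun i _ _ => h0 i
  · rw [Set.indicator_of_notMem hω, mul_zero]
    exact Finset.sum_nonneg fun i _ => h0 i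

/-- The graph has `m` disjoint expanding sets with `k` vertices. -/
def HasDisjointExpanding (G : SimpleGraph (Fin n)) (θ A : ℝ) (k m : ℕ) : Prop :=
  ∃ 𝒯 : Finset (Finset (Fin n)), 𝒯.card = m ∧
    (∀ S ∈ 𝒯, ∀ T ∈ 𝒯, S ≠ T → Disjoint S T) ∧ ∀ T ∈ 𝒯, T.card = k ∧ IsExpanding G θ A T

/-- The first moment of one witness: `n` roots, `(4b)^k` for connected sets, `2^(k+1)` for the
subset, and density `θ` in the Chernoff cost. -/
lemma sum_pairs_le (p : Sym2 (Fin n) → unitInterval) {b : ℝ}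
    (hb : ∀ v, ∑ w, (p s(v, w) : ℝ) ≤ b) {θ κ : ℝ} (hκ : 0 ≤ κ) (k : ℕ) :
    ∑ i : Finset (Fin n) × Finset (Fin n) with
        i.1.card = k + 1 ∧ i.2 ⊆ i.1 ∧ θ * i.1.card ≤ i.2.card,
      connProb p i.1 * Real.exp (-κ * i.2.card) ≤
    n * ((4 * b) ^ k * (2 ^ (k + 1) * Real.exp (-(κ * θ * (k + 1))))) := by
  have hw : ∀ i : Finset (Fin n) × Finset (Fin n),
      0 ≤ connProb p i.1 * Real.exp (-κ * i.2.card) := fun i =>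
    mul_nonneg (connProb_nonneg p _) (Real.exp_pos _).le
  have hK : (0 : ℝ) ≤ 2 ^ (k + 1) * Real.exp (-(κ * θ * (k + 1))) := by positivity
  have hT : ∀ T : Finset (Fin n), T.card = k + 1 →
      ∑ S ∈ T.powerset.filter (fun S => θ * T.card ≤ S.card),
        connProb p T * Real.exp (-κ * S.card) ≤
      connProb p T * (2 ^ (k + 1) * Real.exp (-(κ * θ * (k + 1)))) := by
    intro T hc
    rw [← Finset.mul_sum]
    refine mul_le_mul_of_nonneg_left ?_ (connProb_nonneg p _)
    refine (Finset.sum_le_card_nsmul _ _ (Real.exp (-(κ * θ * (k + 1)))) fun S hS => ?_).trans ?_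
    · have h := (Finset.mem_filter.1 hS).2
      rw [hc] at h
      push_cast at h
      refine Real.exp_le_exp.2 ?_
      nlinarith [mul_le_mul_of_nonneg_left h hκ]
    · rw [nsmul_eq_mul]
      refine mul_le_mul_of_nonneg_right ?_ (Real.exp_pos _).le
      have := Finset.card_filter_le T.powerset (fun S => θ * T.card ≤ (S.card : ℝ))
      rw [Finset.card_powerset, hc] at this
      rw [hc]
      exact_mod_cast this
  have hR : ∀ x : Fin n, ∑ T ∈ rootedSets x (k + 1),
      connProb p T * (2 ^ (k + 1) * Real.exp (-(κ * θ * (k + 1)))) ≤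
      (4 * b) ^ k * (2 ^ (k + 1) * Real.exp (-(κ * θ * (k + 1)))) := fun x => by
    rw [← Finset.sum_mul]
    exact mul_le_mul_of_nonneg_right (sum_connProb_le p hb k x) hK
  calc _ = ∑ T : Finset (Fin n), if T.card = k + 1 then
          ∑ S ∈ T.powerset.filter (fun S => θ * T.card ≤ S.card),
            connProb p T * Real.exp (-κ * S.card) else 0 := by
        rw [Finset.sum_filter, Fintype.sum_prod_type]
        refine Finset.sum_congr rfl fun T _ => ?_
        split_ifs with h
        · rw [Finset.sum_filter, ← Finset.filter_univ_mem T.powerset, Finset.sum_filter]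
          refine Finset.sum_congr rfl fun S _ => ?_
          by_cases hS : S ⊆ T <;> simp [h, hS]
        · simp [h]
    _ ≤ ∑ T : Finset (Fin n), ∑ x : Fin n, if T ∈ rootedSets x (k + 1) then
          connProb p T * (2 ^ (k + 1) * Real.exp (-(κ * θ * (k + 1)))) else 0 := by
        have h0 : ∀ (T : Finset (Fin n)) (x : Fin n), 0 ≤ if T ∈ rootedSets x (k + 1) then
            connProb p T * (2 ^ (k + 1) * Real.exp (-(κ * θ * (k + 1)))) else 0 := fun T x => by
          split_ifs
          exacts [mul_nonneg (connProb_nonneg p _) hK, le_rfl]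
        refine Finset.sum_le_sum fun T _ => ?_
        split_ifs with h
        · obtain ⟨x, hx⟩ := Finset.card_pos.1 (h.symm ▸ Nat.succ_pos k : 0 < T.card)
          refine (hT T h).trans (le_trans (le_of_eq ?_)
            (Finset.single_le_sum (fun x _ => h0 T x) (Finset.mem_univ x)))
          rw [if_pos (by simp [rootedSets, hx, h])]
        · exact Finset.sum_nonneg fun x _ => h0 T x
    _ = ∑ x : Fin n, ∑ T ∈ rootedSets x (k + 1),
          connProb p T * (2 ^ (k + 1) * Real.exp (-(κ * θ * (k + 1)))) := by
        rw [Finset.sum_comm]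
        refine Finset.sum_congr rfl fun x _ => ?_
        rw [← Finset.sum_filter, Finset.filter_univ_mem]
    _ ≤ _ := by
        refine (Finset.sum_le_card_nsmul _ _ _ fun x _ => hR x).trans (le_of_eq ?_)
        simp

lemma edgeMeasure_real_hasDisjointExpanding_le (p : Sym2 (Fin n) → unitInterval) {b : ℝ}
    (hb : ∀ v, ∑ w, (p s(v, w) : ℝ) ≤ b) {t a κ θ A : ℝ} (ht : 0 ≤ t) (hκ0 : 0 ≤ κ)
    (hκ : (Real.exp (2 * t) - 1) / 2 * b - t * a ≤ -κ) (hθ : 0 < θ) (hA : 1 / θ + a ≤ A)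
    (k m : ℕ) :
    (edgeMeasure p).real {ω | HasDisjointExpanding (graphOf ω) θ A (k + 1) m} ≤
      (n * ((4 * b) ^ k * (2 ^ (k + 1) * Real.exp (-(κ * θ * (k + 1)))))) ^ m / m.factorial := by
  classical
  rw [le_div_iff₀ (by positivity), mul_comm]
  set Q : Finset (Finset (Fin n) × Finset (Fin n)) := Finset.univ.filter fun i =>
    i.1.card = k + 1 ∧ i.2 ⊆ i.1 ∧ θ * i.1.card ≤ i.2.card with hQ
  set F : Finset (Fin m → Finset (Fin n) × Finset (Fin n)) :=
    (Fintype.piFinset fun _ => Q).filter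
      fun f => Pairwise fun i j => Disjoint (f i).1 (f j).1 with hF
  let ev : (Fin m → Finset (Fin n) × Finset (Fin n)) → Set (Sym2 (Fin n) → Bool) := fun f =>
    {ω | ∀ i, IsConn (graphOf ω) (f i).1 ∧
      ((f i).1.card : ℝ) + a * (f i).2.card ≤ (closedNbhd (graphOf ω) (f i).2).card}
  have hw : ∀ i : Finset (Fin n) × Finset (Fin n),
      0 ≤ connProb p i.1 * Real.exp (-κ * i.2.card) := fun i =>
    mul_nonneg (connProb_nonneg p _) (Real.exp_pos _).le
  calc (m.factorial : ℝ) * (edgeMeasure p).real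
        {ω | HasDisjointExpanding (graphOf ω) θ A (k + 1) m}
      ≤ ∑ f ∈ F, (edgeMeasure p).real (ev f) := by
        refine mul_measureReal_le_sum_of_card_le _ F ev _ _
          (fun ω => F.filter fun f => ω ∈ ev f) (fun ω _ => Finset.filter_subset _ _)
          (fun ω _ f hf => (Finset.mem_filter.1 hf).2) ?_
        rintro ω ⟨𝒯, hcard, hdis, hexp⟩
        choose! S hST hS1 hS2 using fun T hT => (hexp T hT).2.2
        have e : Fin m ≃ 𝒯 := (𝒯.equivFinOfCardEq hcard).symm
        have hne : ∀ T ∈ 𝒯, T.Nonempty := fun T hT => (hexp T hT).2.1.1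
        have hgood : ∀ σ : Equiv.Perm (Fin m),
            (fun i => ((e (σ i) : Finset (Fin n)), S (e (σ i)))) ∈
              F.filter fun f => ω ∈ ev f := by
          intro σ
          refine Finset.mem_filter.2 ⟨Finset.mem_filter.2 ⟨Fintype.mem_piFinset.2 fun i => ?_, ?_⟩,
            fun i => ⟨(hexp _ (e (σ i)).2).2.1, ?_⟩⟩
          · exact Finset.mem_filter.2 ⟨Finset.mem_univ _, (hexp _ (e (σ i)).2).1,
              hST _ (e (σ i)).2, hS1 _ (e (σ i)).2⟩
          · intro i j hij
            refine hdis _ (e (σ i)).2 _ (e (σ j)).2 fun h => hij ?_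
            exact σ.injective (e.injective (Subtype.ext h))
          · have h1 := hS1 _ (e (σ i)).2
            have h2 := hS2 _ (e (σ i)).2
            refine le_trans ?_ h2.le
            -- Density `θ` gives `|T| ≤ |S|/θ`, so the vertices of `T` itself use up only the part
            -- `1/θ` of the growth factor `A`, and `a` remains for edges leaving `T`.
            have h3 : ((e (σ i) : Finset (Fin n)).card : ℝ) ≤
                1 / θ * (S (e (σ i))).card := by
              rw [one_div, ← div_eq_inv_mul, le_div_iff₀ hθ]
              linarith
            have h4 := mul_le_mul_of_nonneg_right hA
              (Nat.cast_nonneg (α := ℝ) (S (e (σ i))).card)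
            dsimp only
            linarith
        have hcp : m.factorial = (Finset.univ : Finset (Equiv.Perm (Fin m))).card := by
          rw [Finset.card_univ, Fintype.card_perm, Fintype.card_fin]
        rw [hcp]
        refine Finset.card_le_card_of_injOn
          (fun σ i => ((e (σ i) : Finset (Fin n)), S (e (σ i)))) (fun σ _ => hgood σ) ?_
        intro σ _ τ _ h
        ext i
        have := congrFun h i
        have h5 : (e (σ i) : Finset (Fin n)) = e (τ i) := congrArg Prod.fst this
        rw [e.injective (Subtype.ext h5)]
    _ ≤ ∑ f ∈ F, ∏ i, connProb p (f i).1 * Real.exp (-κ * (f i).2.card) := by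
        refine Finset.sum_le_sum fun f hf => ?_
        obtain ⟨h1, h2⟩ := Finset.mem_filter.1 hf
        exact edgeMeasure_real_family_le p hb ht hκ f h2 fun i =>
          (Finset.mem_filter.1 (Fintype.mem_piFinset.1 h1 i)).2.2.1
    _ ≤ ∑ f ∈ Fintype.piFinset fun _ : Fin m => Q,
        ∏ i, connProb p (f i).1 * Real.exp (-κ * (f i).2.card) :=
        Finset.sum_le_sum_of_subset_of_nonneg (Finset.filter_subset _ _)
          fun f _ _ => Finset.prod_nonneg fun i _ => hw _
    _ = (∑ i ∈ Q, connProb p i.1 * Real.exp (-κ * i.2.card)) ^ m := by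
        rw [Finset.sum_pow']
    _ ≤ _ := pow_le_pow_left₀ (Finset.sum_nonneg fun i _ => hw i) (sum_pairs_le p hb hκ0 k) m

end UnionBound

/-! ### Balls, geodesics and paths in the excision. -/

section Balls

variable {V : Type*} {G H : SimpleGraph V}

lemma mem_ballSet_iff {u v : V} {ℓ : ℕ} :
    u ∈ ballSet G v ℓ ↔ ∃ p : G.Walk v u, p.length ≤ ℓ := by
  constructor
  · intro h
    have hne : G.edist v u ≠ ⊤ := ne_top_of_le_ne_top (ENat.natCast_ne_top ℓ) h
    obtain ⟨p, hp⟩ := SimpleGraph.exists_walk_of_edist_ne_top hne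
    refine ⟨p, ?_⟩
    have h' : (p.length : ℕ∞) ≤ ℓ := hp.trans_le h
    exact_mod_cast h'
  · rintro ⟨p, hp⟩
    exact (SimpleGraph.edist_le p).trans (by exact_mod_cast hp)

lemma mem_ballSet_self (v : V) (ℓ : ℕ) : v ∈ ballSet G v ℓ :=
  mem_ballSet_iff.2 ⟨.nil, by simp⟩

lemma mem_ballSet_zero {u v : V} : u ∈ ballSet G v 0 ↔ u = v := by
  rw [mem_ballSet_iff]
  constructor
  · rintro ⟨p, hp⟩
    exact (SimpleGraph.Walk.eq_of_length_eq_zero (Nat.le_zero.1 hp)).symm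
  · rintro rfl
    exact ⟨.nil, by simp⟩

lemma ballSet_mono {v : V} {ℓ m : ℕ} (h : ℓ ≤ m) : ballSet G v ℓ ⊆ ballSet G v m :=
  fun _ hu => le_trans (b := (ℓ : ℕ∞)) hu (by exact_mod_cast h)

lemma ballSet_mono_graph (h : H ≤ G) {v : V} {ℓ : ℕ} : ballSet H v ℓ ⊆ ballSet G v ℓ :=
  fun _ hu => (SimpleGraph.edist_anti h).trans hu

lemma mem_ballSet_comm {u v : V} {ℓ : ℕ} : u ∈ ballSet G v ℓ ↔ v ∈ ballSet G u ℓ := by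
  simp only [ballSet, Set.mem_ofPred_eq, SimpleGraph.edist_comm]

lemma mem_ballSet_trans {u v w : V} {ℓ m : ℕ} (h : v ∈ ballSet G u ℓ) (h' : w ∈ ballSet G v m) :
    w ∈ ballSet G u (ℓ + m) := by
  obtain ⟨p, hp⟩ := mem_ballSet_iff.1 h
  obtain ⟨q, hq⟩ := mem_ballSet_iff.1 h'
  exact mem_ballSet_iff.2 ⟨p.append q, by rw [SimpleGraph.Walk.length_append]; omega⟩

lemma mem_ballSet_of_adj {u v : V} (h : G.Adj u v) : v ∈ ballSet G u 1 :=
  mem_ballSet_iff.2 ⟨h.toWalk, by simp⟩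

lemma reachable_of_mem_ballSet {u v : V} {ℓ : ℕ} (h : u ∈ ballSet G v ℓ) : G.Reachable v u := by
  obtain ⟨p, -⟩ := mem_ballSet_iff.1 h
  exact ⟨p⟩

lemma exists_adj_of_mem_ballSet_succ {u v : V} {ℓ : ℕ} (h : u ∈ ballSet G v (ℓ + 1)) :
    u ∈ ballSet G v ℓ ∨ ∃ w ∈ ballSet G v ℓ, G.Adj w u := by
  rw [mem_ballSet_comm] at h
  obtain ⟨p, hp⟩ := mem_ballSet_iff.1 h
  cases p with
  | nil => exact Or.inl (mem_ballSet_self _ _)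
  | @cons _ w _ hw q =>
    refine Or.inr ⟨w, ?_, hw.symm⟩
    rw [mem_ballSet_comm]
    exact mem_ballSet_iff.2 ⟨q, by simpa using hp⟩

lemma isConn_of_ballSet_subset {S : Finset V} {v : V} {i : ℕ}
    (h1 : ∀ u ∈ ballSet G v i, u ∈ S) (h2 : ∀ u ∈ S, u ∈ ballSet G v (i + 1)) :
    IsConn G S := by
  have hv : v ∈ S := h1 v (mem_ballSet_self _ _)
  have key : ∀ j ≤ i + 1, ∀ u ∈ S, u ∈ ballSet G v j → (within G S).Reachable u v := by
    intro j
    induction j with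
    | zero =>
      intro _ u _ hu
      rw [mem_ballSet_zero.1 hu]
    | succ j ih =>
      intro hj u hu hub
      rcases exists_adj_of_mem_ballSet_succ hub with h | ⟨w, hw, hwu⟩
      · exact ih (by omega) u hu h
      · have hwS : w ∈ S := h1 w (ballSet_mono (by omega) hw)
        have hadj : (within G S).Adj u w := ⟨hwu.symm, hu, hwS⟩
        exact hadj.reachable.trans (ih (by omega) w hwS hw)
  exact isConn_of_center hv fun u hu => key (i + 1) le_rfl u hu (h2 u hu)

lemma exists_adj_crossing {u v : V} (h : G.Reachable u v) {P : V → Prop} (hu : P u) (hv : ¬ P v) :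
    ∃ a b, G.Reachable u a ∧ P a ∧ ¬ P b ∧ G.Adj a b := by
  by_contra! hcon
  rw [SimpleGraph.reachable_iff_reflTransGen] at h
  refine hv ?_
  clear hv
  induction h with
  | refl => exact hu
  | @tail b c hb hbc ih =>
    by_contra hc
    exact hcon b c ((SimpleGraph.reachable_iff_reflTransGen _ _).2 hb) ih hc hbc

lemma excision_le {D : ℝ} : excision G D ≤ G := fun _ _ h => h.1

/-- A shortest path from `v` stays in its excised ball, so all its edges survive in the excision. -/
lemma ballSet_subset_ballSet_excision {D : ℝ} {v : V} {j : ℕ} (hj : j ≤ radius G D v) :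
    ballSet G v j ⊆ ballSet (excision G D) v j := by
  induction j with
  | zero =>
    intro u hu
    rw [mem_ballSet_zero] at hu ⊢
    exact hu
  | succ j ih =>
    intro u hu
    rcases exists_adj_of_mem_ballSet_succ hu with h | ⟨w, hw, hwu⟩
    · exact ballSet_mono (by omega) (ih (by omega) h)
    · refine mem_ballSet_trans (ih (by omega) hw) (mem_ballSet_of_adj ⟨hwu, v, ?_, ?_⟩)
      · exact ballSet_mono (by omega) hw
      · exact ballSet_mono hj hu

lemma exists_center_of_adj_excision {D : ℝ} {u w : V} (h : (excision G D).Adj u w) :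
    ∃ v, 0 < radius G D v ∧ u ∈ ballSet G v (radius G D v) := by
  obtain ⟨hadj, v, hu, hw⟩ := h
  refine ⟨v, Nat.pos_of_ne_zero fun h0 => ?_, hu⟩
  rw [h0, mem_ballSet_zero] at hu hw
  exact hadj.ne (hu.trans hw.symm)

/-- The walk is a shortest one from `y` to `z`: a shortcut between two of its vertices would shorten
it. -/
lemma exists_geodesic {y z : V} {R : ℕ} (hr : H.Reachable y z) (hz : z ∉ ballSet H y R) :
    ∃ f : ℕ → V, f 0 = y ∧ (∀ j < R, H.Adj (f j) (f (j + 1))) ∧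
      ∀ i ≤ R, ∀ j ≤ R, ∀ ℓ, f j ∈ ballSet H (f i) ℓ → j ≤ i + ℓ := by
  obtain ⟨p, hp⟩ := hr.exists_walk_length_eq_dist
  have hlen : R < p.length := by
    by_contra h
    exact hz (mem_ballSet_iff.2 ⟨p, by omega⟩)
  refine ⟨p.getVert, p.getVert_zero, fun j hj => p.adj_getVert_succ (by omega), ?_⟩
  intro i hi j hj ℓ h
  obtain ⟨q, hq⟩ := mem_ballSet_iff.1 h
  have := SimpleGraph.dist_le (((p.take i).append q).append (p.drop j))
  rw [← hp, SimpleGraph.Walk.length_append, SimpleGraph.Walk.length_append,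
    SimpleGraph.Walk.take_length, SimpleGraph.Walk.drop_length] at this
  omega

variable [DecidableEq V]

lemma card_support_le {u v : V} (p : G.Walk u v) : p.support.toFinset.card ≤ p.length + 1 := by
  rw [← SimpleGraph.Walk.length_support]
  exact List.toFinset_card_le _

lemma IsConn.biUnion {ι : Type*} [DecidableEq ι] {T : Finset V} (hT : IsConn G T) {I : Finset ι}
    {Q : ι → Finset V} (hQ : ∀ i ∈ I, IsConn G (Q i)) (h : ∀ i ∈ I, ∃ x ∈ T, x ∈ Q i) :
    IsConn G (T ∪ I.biUnion Q) := by
  induction I using Finset.induction_on with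
  | empty => simpa using hT
  | @insert a I ha ih =>
    obtain ⟨x, hxT, hxQ⟩ := h a (by simp)
    have h1 := ih (fun i hi => hQ i (by simp [hi])) fun i hi => h i (by simp [hi])
    have h2 := h1.union (hQ a (by simp)) (Finset.mem_union_left _ hxT) hxQ
    convert h2 using 1
    rw [Finset.biUnion_insert, Finset.union_assoc, Finset.union_comm (Q a)]

lemma IsConn.exists_superset_card {S C : Finset V} (hS : IsConn G S) (hC : IsConn G C)
    (hSC : S ⊆ C) {k : ℕ} (hk : S.card ≤ k) (hkC : k ≤ C.card) :
    ∃ T, S ⊆ T ∧ T ⊆ C ∧ IsConn G T ∧ T.card = k := by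
  induction k, hk using Nat.le_induction with
  | base => exact ⟨S, subset_rfl, hSC, hS, rfl⟩
  | succ k hk ih =>
    obtain ⟨T, hST, hTC, hT, hcard⟩ := ih (by omega)
    obtain ⟨z, hzC, hzT⟩ := Finset.exists_of_ssubset
      (Finset.ssubset_iff_subset_ne.2 ⟨hTC, fun h => by rw [h] at hcard; omega⟩)
    obtain ⟨x, hx⟩ := hT.1
    obtain ⟨a, b, -, ha, hb, hab⟩ := exists_adj_crossing (hC.2 x (hTC hx) z hzC)
      (P := fun u => u ∈ T) hx hzT
    exact ⟨insert b T, hST.trans (Finset.subset_insert _ _),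
      Finset.insert_subset hab.2.2 hTC, hT.insert_adj ha hab.1,
      by rw [Finset.card_insert_of_notMem hb, hcard]⟩

end Balls

/-! ### Expansion inside heavy balls, and nets. -/

section Finite

variable {V : Type*} [Fintype V] {G : SimpleGraph V}

open Classical in
/-- The ball of radius `ℓ` around `v` as a finite set. -/
def ball (G : SimpleGraph V) (v : V) (ℓ : ℕ) : Finset V :=
  Finset.univ.filter fun u => u ∈ ballSet G v ℓ

lemma mem_ball {u v : V} {ℓ : ℕ} : u ∈ ball G v ℓ ↔ u ∈ ballSet G v ℓ := by simp [ball]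

lemma card_ball (v : V) (ℓ : ℕ) : (ball G v ℓ).card = (ballSet G v ℓ).ncard := by
  rw [← Set.ncard_coe_finset]
  congr 1
  ext u
  exact mem_ball

/-- A large ball contains a connected set, of prescribed minimal size `s`, whose closed
neighbourhood is more than `A` times larger. -/
lemma exists_expanding_subset_ball {A : ℝ} (hA : 1 ≤ A) {s L : ℕ} (hs : 1 ≤ s) {v : V}
    (h : s * A ^ L < (ball G v L).card) :
    ∃ S ⊆ ball G v L, v ∈ S ∧ IsConn G S ∧ s ≤ S.card ∧
      A * S.card < (closedNbhd G S).card := by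
  by_contra! hcon
  have hsub : ∀ i S, (∀ u ∈ ballSet G v i, u ∈ S) → ball G v (i + 1) ⊆ closedNbhd G S := by
    intro i S hS u hu
    rcases exists_adj_of_mem_ballSet_succ (mem_ball.1 hu) with h | ⟨w, hw, hwu⟩
    · exact mem_closedNbhd.2 (Or.inl (hS u h))
    · exact mem_closedNbhd.2 (Or.inr ⟨w, hS w hw, hwu⟩)
  have key : ∀ i ≤ L, ((ball G v i).card : ℝ) ≤ s * A ^ i := by
    intro i
    induction i with
    | zero =>
      intro _
      have : (ball G v 0).card = 1 := by
        rw [Finset.card_eq_one]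
        exact ⟨v, by ext u; simp [mem_ball, mem_ballSet_zero]⟩
      rw [this]
      simpa using hs
    | succ i ih =>
      intro hi
      have ihi := ih (by omega)
      have hmono : ball G v i ⊆ ball G v (i + 1) := fun u hu =>
        mem_ball.2 (ballSet_mono (by omega) (mem_ball.1 hu))
      have hmonoL : ball G v (i + 1) ⊆ ball G v L := fun u hu =>
        mem_ball.2 (ballSet_mono hi (mem_ball.1 hu))
      have hAi : (1 : ℝ) ≤ A ^ i := one_le_pow₀ hA
      by_cases h1 : s ≤ (ball G v i).card
      · have h2 := hcon (ball G v i) (hmono.trans hmonoL)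
          (mem_ball.2 (mem_ballSet_self _ _))
          (isConn_of_ballSet_subset (i := i) (fun u hu => mem_ball.2 hu)
            fun u hu => mem_ball.1 (hmono hu)) h1
        have h3 : ((ball G v (i + 1)).card : ℝ) ≤ (closedNbhd G (ball G v i)).card := by
          exact_mod_cast Finset.card_le_card (hsub i _ fun u hu => mem_ball.2 hu)
        calc ((ball G v (i + 1)).card : ℝ) ≤ A * (ball G v i).card := h3.trans h2
          _ ≤ A * (s * A ^ i) := mul_le_mul_of_nonneg_left ihi (by linarith)
          _ = s * A ^ (i + 1) := by ring
      · by_cases h2 : (ball G v (i + 1)).card ≤ s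
        · calc ((ball G v (i + 1)).card : ℝ) ≤ s := by exact_mod_cast h2
            _ ≤ s * A ^ (i + 1) := le_mul_of_one_le_right (by positivity) (one_le_pow₀ hA)
        -- The ball jumps past size `s` in this step, and being smaller than `s` it cannot be tested
        -- itself. It is padded to exactly `s` vertices from the next sphere, which keeps it
        -- connected.
        · obtain ⟨S, hS1, hS2, hS3⟩ := Finset.exists_subsuperset_card_eq hmono
            (n := s) (by omega) (by omega)
          have h4 := hcon S (hS2.trans hmonoL) (hS1 (mem_ball.2 (mem_ballSet_self _ _)))
            (isConn_of_ballSet_subset (i := i) (fun u hu => hS1 (mem_ball.2 hu))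
              fun u hu => mem_ball.1 (hS2 hu)) hS3.ge
          have h3 : ((ball G v (i + 1)).card : ℝ) ≤ (closedNbhd G S).card := by
            exact_mod_cast Finset.card_le_card (hsub i _ fun u hu => hS1 (mem_ball.2 hu))
          calc ((ball G v (i + 1)).card : ℝ) ≤ A * S.card := h3.trans h4
            _ = s * A ^ 1 := by rw [hS3]; ring
            _ ≤ s * A ^ (i + 1) := 
              mul_le_mul_of_nonneg_left (pow_le_pow_right₀ hA (by omega)) (by positivity)
  exact absurd (key L le_rfl) (not_le.2 h)

lemma isLight_of_radius_le {D : ℝ} (hD : 1 < D) {v : V} {L : ℕ} (h : radius G D v ≤ L) :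
    IsLight G D v L := by
  have hne : {ℓ | ∀ L, ℓ ≤ L → IsLight G D v L}.Nonempty := by
    obtain ⟨ℓ, hℓ⟩ := pow_unbounded_of_one_lt (Fintype.card V : ℝ) hD
    refine ⟨ℓ, fun L hL => ?_⟩
    rw [IsLight, ← card_ball]
    calc ((ball G v L).card : ℝ) ≤ Fintype.card V := by
          exact_mod_cast Finset.card_le_univ _
      _ ≤ D ^ ℓ := hℓ.le
      _ ≤ D ^ L := pow_le_pow_right₀ hD.le hL
  exact Nat.sInf_mem hne L h

lemma card_ball_le_of_radius_le {D : ℝ} (hD : 1 < D) {v : V} {L : ℕ} (h : radius G D v ≤ L) :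
    ((ball G v L).card : ℝ) ≤ D ^ L := by
  rw [card_ball]
  exact isLight_of_radius_le hD h

/-- Minimality of the radius makes the ball one step smaller heavy; `L = 0` is excluded because a
single vertex is light. -/
lemma exists_eq_radius_of_pos {D : ℝ} (hD : 1 < D) {v : V} (h : 0 < radius G D v) :
    ∃ L, 1 ≤ L ∧ radius G D v = L + 1 ∧ D ^ L < (ball G v L).card := by
  obtain ⟨L, hL⟩ := Nat.exists_eq_add_of_lt h
  rw [zero_add] at hL
  have hheavy : ¬ IsLight G D v L := by
    intro hl
    have : radius G D v ≤ L := by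
      refine Nat.sInf_le fun M hM => ?_
      rcases hM.eq_or_lt with rfl | hM
      · exact hl
      · exact isLight_of_radius_le hD (by omega)
    omega
  refine ⟨L, ?_, hL, ?_⟩
  · by_contra h0
    obtain rfl : L = 0 := by omega
    refine hheavy ?_
    have : ballSet G v 0 = {v} := by ext u; simp [mem_ballSet_zero]
    simp [IsLight, this]
  · rw [card_ball]
    exact not_le.1 hheavy

/-- A connected set containing an `ℓ`-separated `ℓ`-net of the component of `x`. -/
lemma exists_net [DecidableEq V] (H : SimpleGraph V) (x : V) (ℓ : ℕ) :
    ∃ Y T : Finset V, x ∈ Y ∧ Y ⊆ T ∧ IsConn H T ∧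
      (∀ y ∈ Y, ∀ z ∈ Y, y ≠ z → z ∉ ballSet H y ℓ) ∧ T.card ≤ (ℓ + 1) * Y.card ∧
      ∀ u, H.Reachable x u → ∃ y ∈ Y, u ∈ ballSet H y ℓ := by
  classical
  let good : Finset V → Prop := fun Y => x ∈ Y ∧
    (∀ y ∈ Y, ∀ z ∈ Y, y ≠ z → z ∉ ballSet H y ℓ) ∧
    ∃ T, Y ⊆ T ∧ IsConn H T ∧ T.card ≤ (ℓ + 1) * Y.card
  have h0 : good {x} := by
    refine ⟨by simp, ?_, {x}, subset_rfl, isConn_singleton _ _, by simp⟩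
    intro y hy z hz hyz
    exact absurd ((Finset.mem_singleton.1 hy).trans (Finset.mem_singleton.1 hz).symm) hyz
  obtain ⟨Y, hY, hmax⟩ := Finset.exists_max_image (Finset.univ.filter good) Finset.card
    ⟨{x}, Finset.mem_filter.2 ⟨Finset.mem_univ _, h0⟩⟩
  obtain ⟨hxY, hsep, T, hYT, hT, hcard⟩ := (Finset.mem_filter.1 hY).2
  refine ⟨Y, T, hxY, hYT, hT, hsep, hcard, ?_⟩
  by_contra! hcon
  obtain ⟨u, hu, hfar⟩ := hcon
  -- An edge leaving the covered region gives `b` at distance at most `ℓ+1` from some `y ∈ Y`, so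
  -- joining it costs at most `ℓ+1` new vertices and contradicts maximality of `Y`.
  obtain ⟨a, b, -, ⟨y, hy, ha⟩, hb, hab⟩ := exists_adj_crossing hu
    (P := fun u => ∃ y ∈ Y, u ∈ ballSet H y ℓ) ⟨x, hxY, mem_ballSet_self _ _⟩
    (by push Not; exact hfar)
  push Not at hb
  have hbY : b ∉ Y := fun h => hb b h (mem_ballSet_self _ _)
  obtain ⟨p, hp⟩ := mem_ballSet_iff.1 (mem_ballSet_trans ha (mem_ballSet_of_adj hab))
  have hnew : good (insert b Y) := by
    refine ⟨Finset.mem_insert_of_mem hxY, ?_, T ∪ p.support.toFinset, ?_, ?_, ?_⟩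
    · intro y' hy' z hz hne
      rcases Finset.mem_insert.1 hy' with rfl | hy'' <;>
        rcases Finset.mem_insert.1 hz with rfl | hz'
      · exact absurd rfl hne
      · rw [mem_ballSet_comm]
        exact hb z hz'
      · exact hb y' hy''
      · exact hsep y' hy'' z hz' hne
    · refine Finset.insert_subset (Finset.mem_union_right _ (by simp))
        (hYT.trans Finset.subset_union_left)
    · exact hT.union (isConn_support p) (hYT hy) (by simp)
    · have h1 : T ∪ p.support.toFinset = T ∪ (p.support.toFinset.erase y) := by
        ext z
        simp only [Finset.mem_union, Finset.mem_erase]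
        constructor
        · rintro (h | h)
          · exact Or.inl h
          · by_cases hz : z = y
            · exact Or.inl (hz ▸ hYT hy)
            · exact Or.inr ⟨hz, h⟩
        · rintro (h | h)
          exacts [Or.inl h, Or.inr h.2]
      have h2 := Finset.card_union_le T (p.support.toFinset.erase y)
      have h3 : (p.support.toFinset.erase y).card = p.support.toFinset.card - 1 :=
        Finset.card_erase_of_mem (by simp)
      have h4 := card_support_le p
      rw [h1, Finset.card_insert_of_notMem hbY, mul_add, mul_one]
      omega
  have := hmax _ (Finset.mem_filter.2 ⟨Finset.mem_univ _, hnew⟩)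
  rw [Finset.card_insert_of_notMem hbY] at this
  omega

end Finite

/-! ### A Vitali selection joined into one connected skeleton. -/

section Skeleton

variable {V : Type*} [DecidableEq V] {G H : SimpleGraph V}

/-- Around a vertex `y` with a vertex farther than `R` in its component there is a connected set of
`R + 1` vertices that meets every ball of radius `ℓ` in at most `2 * ℓ + 1` vertices. -/
lemma exists_long_set {y z : V} {R : ℕ} (hr : H.Reachable y z) (hz : z ∉ ballSet H y R) :
    ∃ P : Finset V, y ∈ P ∧ IsConn H P ∧ P.card = R + 1 ∧ (∀ u ∈ P, u ∈ ballSet H y R) ∧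
      ∀ Q ⊆ P, ∀ (v : V) (ℓ : ℕ), (∀ u ∈ Q, u ∈ ballSet H v ℓ) → Q.card ≤ 2 * ℓ + 1 := by
  obtain ⟨f, h0, hadj, hgeo⟩ := exists_geodesic hr hz
  have hball : ∀ j ≤ R, f j ∈ ballSet H y j := by
    intro j
    induction j with
    | zero => intro _; rw [h0]; exact mem_ballSet_self _ _
    | succ j ih =>
      intro hj
      exact mem_ballSet_trans (ih (by omega)) (mem_ballSet_of_adj (hadj j (by omega)))
  have hinj : Set.InjOn f (Finset.range (R + 1)) := by
    intro i hi j hj hij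
    simp only [Finset.coe_range, Set.mem_Iio] at hi hj
    have h1 := hgeo i (by omega) j (by omega) 0 (by rw [hij]; exact mem_ballSet_self _ _)
    have h2 := hgeo j (by omega) i (by omega) 0 (by rw [hij]; exact mem_ballSet_self _ _)
    omega
  refine ⟨(Finset.range (R + 1)).image f, ?_, ?_, ?_, ?_, ?_⟩
  · exact Finset.mem_image.2 ⟨0, by simp, h0⟩
  · have : ∀ j ≤ R, IsConn H ((Finset.range (j + 1)).image f) := by
      intro j
      induction j with
      | zero => intro _; simpa using isConn_singleton H (f 0)
      | succ j ih =>
        intro hj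
        rw [Finset.range_add_one, Finset.image_insert]
        exact (ih (by omega)).insert_adj (x := f j)
          (Finset.mem_image_of_mem _ (by simp)) (hadj j (by omega))
    exact this R le_rfl
  · rw [Finset.card_image_of_injOn hinj, Finset.card_range]
  · intro u hu
    obtain ⟨j, hj, rfl⟩ := Finset.mem_image.1 hu
    have hj' : j ≤ R := by simpa [Nat.lt_succ_iff] using hj
    exact ballSet_mono hj' (hball j hj')
  · intro Q hQ v ℓ hv
    set J := (Finset.range (R + 1)).filter fun j => f j ∈ Q with hJ
    have hQJ : Q ⊆ J.image f := by
      intro u hu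
      obtain ⟨j, hj, rfl⟩ := Finset.mem_image.1 (hQ hu)
      exact Finset.mem_image_of_mem _ (Finset.mem_filter.2 ⟨hj, hu⟩)
    refine (Finset.card_le_card hQJ).trans (Finset.card_image_le.trans ?_)
    rcases J.eq_empty_or_nonempty with h | h
    · simp [h]
    · set i := J.min' h with hi
      have hiJ := Finset.mem_filter.1 (J.min'_mem h)
      refine (Finset.card_le_card (t := Finset.Icc i (i + 2 * ℓ)) fun j hj => ?_).trans
        (by rw [Nat.card_Icc]; omega)
      have hjJ := Finset.mem_filter.1 hj
      refine Finset.mem_Icc.2 ⟨J.min'_le _ hj, ?_⟩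
      rw [two_mul]
      refine hgeo i (by simpa [Nat.lt_succ_iff] using hiJ.1) j
        (by simpa [Nat.lt_succ_iff] using hjJ.1) _ ?_
      exact mem_ballSet_trans (mem_ballSet_comm.1 (hv _ hiJ.2)) (hv _ hjJ.2)

/-- Given local sets `S v ⊆ B v` around the vertices of `c`, such that the `B v` cover a component
of large diameter, a disjoint subfamily of the `B v` can be joined up economically. -/
lemma exists_skeleton [Fintype V] (hHG : H ≤ G) (x : V) {R : ℕ} (hR : 1 ≤ R) (r : V → ℕ)
    (B S : V → Finset V) (c : Set V)
    (hr : ∀ v ∈ c, 1 ≤ r v ∧ r v ≤ R) (hS : ∀ v ∈ c, v ∈ S v ∧ S v ⊆ B v ∧ IsConn G (S v))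
    (hB : ∀ v ∈ c, ∀ u ∈ B v, u ∈ ballSet H v (r v))
    (hcover : ∀ u, H.Reachable x u → ∃ v ∈ c, u ∈ B v) :
    (∃ y, H.Reachable x y ∧ ∀ u, H.Reachable x u → u ∈ ballSet H y (12 * R)) ∨
    ∃ Y T I : Finset V, (∀ y ∈ Y, H.Reachable x y) ∧
      (∀ u, H.Reachable x u → ∃ y ∈ Y, u ∈ ballSet H y (12 * R)) ∧
      IsConn G T ∧ (∀ u ∈ T, H.Reachable x u) ∧ Y ⊆ T ∧ R ≤ T.card ∧
      (∀ v ∈ I, v ∈ c ∧ S v ⊆ T) ∧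
      (∀ v ∈ I, ∀ w ∈ I, v ≠ w → Disjoint (B v) (B w)) ∧
      T.card ≤ ∑ v ∈ I, (167 * r v + (S v).card) := by
  classical
  -- At separation `12R`, the paths `P y` of length `R` attached to distinct net points stay more
  -- than `10R` apart. A ball of radius `5r ≤ 5R` therefore meets only one of them.
  obtain ⟨Y, T₀, hxY, hYT, hT₀, hsep, hcard, hnet⟩ := exists_net H x (12 * R)
  have hxr : ∀ u ∈ T₀, H.Reachable x u := fun u hu =>
    (hT₀.2 x (hYT hxY) u hu).mono within_le
  by_cases hY : ∃ z ∈ Y, z ≠ x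
  swap
  · push Not at hY
    refine Or.inl ⟨x, SimpleGraph.Reachable.refl _, fun u hu => ?_⟩
    obtain ⟨y, hy, h⟩ := hnet u hu
    rwa [hY y hy] at h
  right
  have hother : ∀ y ∈ Y, ∃ z ∈ Y, y ≠ z := by
    intro y hy
    obtain ⟨z, hz, hzx⟩ := hY
    by_cases h : y = z
    · exact ⟨x, hxY, fun h' => hzx (h ▸ h')⟩
    · exact ⟨z, hz, h⟩
  have hP : ∀ y ∈ Y, ∃ P : Finset V, y ∈ P ∧ IsConn H P ∧ P.card = R + 1 ∧
      (∀ u ∈ P, u ∈ ballSet H y R) ∧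
      ∀ Q ⊆ P, ∀ (v : V) (ℓ : ℕ), (∀ u ∈ Q, u ∈ ballSet H v ℓ) → Q.card ≤ 2 * ℓ + 1 := by
    intro y hy
    obtain ⟨z, hz, hyz⟩ := hother y hy
    exact exists_long_set ((hxr y (hYT hy)).symm.trans (hxr z (hYT hz)))
      fun h => hsep y hy z hz hyz (ballSet_mono (by omega) h)
  choose! P hyP hPc hPcard hPball hPthin using hP
  set U := Y.biUnion P with hU
  have hUr : ∀ u ∈ U, H.Reachable x u := by
    intro u hu
    obtain ⟨y, hy, huy⟩ := Finset.mem_biUnion.1 hu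
    exact (hxr y (hYT hy)).trans (reachable_of_mem_ballSet (hPball y hy u huy))
  have hclose : ∀ y ∈ Y, ∀ z ∈ Y, ∀ u ∈ P y, ∀ w ∈ P z, ∀ ℓ ≤ 10 * R,
      w ∈ ballSet H u ℓ → y = z := by
    intro y hy z hz u hu w hw ℓ hℓ h
    by_contra hyz
    refine hsep y hy z hz hyz (ballSet_mono ?_ (mem_ballSet_trans (mem_ballSet_trans
      (hPball y hy u hu) h) (mem_ballSet_comm.1 (hPball z hz w hw))))
    omega
  have hUcard : U.card = Y.card * (R + 1) := by
    rw [hU, Finset.card_biUnion, Finset.sum_congr rfl hPcard, Finset.sum_const, smul_eq_mul]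
    intro y hy z hz hyz
    refine Finset.disjoint_left.2 fun u hu hu' => ?_
    exact hyz (hclose y hy z hz u hu u hu' 0 (by omega) (mem_ballSet_self _ _))
  set t : Set V := {v | v ∈ c ∧ ∃ u ∈ U, u ∈ B v} with ht
  -- Every `B a` meeting the paths hits a selected `B b` with `r a ≤ 2 * r b`, so it lies in the
  -- ball of radius `r b + 2 * r a ≤ 5 * r b`. Such a ball holds at most `10 * r b + 1 ≤ 11 * r b`
  -- path vertices.
  obtain ⟨I', hI't, hI'd, hI'c⟩ := Vitali.exists_disjoint_subfamily_covering_enlargement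
    (fun v => (B v : Set V)) t (fun v => (r v : ℝ)) 2 one_lt_two (fun v _ => Nat.cast_nonneg _) R
    (fun v hv => by exact_mod_cast (hr v hv.1).2)
    (fun v hv => ⟨v, (hS v hv.1).2.1 (hS v hv.1).1⟩)
  set I := I'.toFinset with hI
  have hIt : ∀ v ∈ I, v ∈ c ∧ ∃ u ∈ U, u ∈ B v := fun v hv => hI't (by simpa [hI] using hv)
  have hQ : ∀ v ∈ I, ∃ Q : Finset V, v ∈ Q ∧ (∃ u ∈ U, u ∈ Q) ∧ IsConn H Q ∧
      Q.card ≤ r v + 1 := by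
    intro v hv
    obtain ⟨hvc, u, hu, huB⟩ := hIt v hv
    obtain ⟨p, hp⟩ := mem_ballSet_iff.1 (hB v hvc u huB)
    exact ⟨p.support.toFinset, by simp, ⟨u, hu, by simp⟩, isConn_support p,
      (card_support_le p).trans (by omega)⟩
  choose! Q hvQ hQU hQc hQcard using hQ
  have hUsum : U.card ≤ ∑ v ∈ I, 11 * r v := by
    have hsub : U ⊆ I.biUnion fun v => U.filter fun u => u ∈ ballSet H v (5 * r v) := by
      intro u hu
      obtain ⟨a, hac, hua⟩ := hcover u (hUr u hu)
      obtain ⟨b, hb, ⟨w, hwa, hwb⟩, hab⟩ := hI'c a ⟨hac, u, hu, hua⟩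
      have hbc := (hI't hb).1
      refine Finset.mem_biUnion.2 ⟨b, by simpa [hI] using hb, Finset.mem_filter.2 ⟨hu, ?_⟩⟩
      have hab' : r a ≤ 2 * r b := by exact_mod_cast hab
      exact ballSet_mono (by omega) (mem_ballSet_trans (mem_ballSet_trans (hB b hbc w hwb)
        (mem_ballSet_comm.1 (hB a hac w hwa))) (hB a hac u hua))
    refine (Finset.card_le_card hsub).trans (Finset.card_biUnion_le.trans
      (Finset.sum_le_sum fun v hv => ?_))
    obtain ⟨hvc, -⟩ := hIt v hv
    have hrv := hr v hvc
    rcases (U.filter fun u => u ∈ ballSet H v (5 * r v)).eq_empty_or_nonempty with h | ⟨u, hu⟩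
    · rw [h]; simp
    · obtain ⟨huU, hub⟩ := Finset.mem_filter.1 hu
      obtain ⟨y, hy, huy⟩ := Finset.mem_biUnion.1 huU
      refine (hPthin y hy _ ?_ v (5 * r v) fun w hw => (Finset.mem_filter.1 hw).2).trans (by omega)
      intro w hw
      obtain ⟨hwU, hwb⟩ := Finset.mem_filter.1 hw
      obtain ⟨z, hz, hwz⟩ := Finset.mem_biUnion.1 hwU
      rwa [hclose y hy z hz u huy w hwz (5 * r v + 5 * r v) (by omega)
        (mem_ballSet_trans (mem_ballSet_comm.1 hub) hwb)]
  have hT₁ : IsConn G (T₀ ∪ U) := (hT₀.biUnion hPc fun y hy =>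
    ⟨y, hYT hy, hyP y hy⟩).mono_graph hHG
  have hT₂ : IsConn G (T₀ ∪ U ∪ I.biUnion fun v => Q v ∪ S v) := by
    refine hT₁.biUnion (fun v hv => ?_) fun v hv => ?_
    · obtain ⟨h1, h2, h3⟩ := hS v (hIt v hv).1
      exact ((hQc v hv).mono_graph hHG).union h3 (hvQ v hv) h1
    · obtain ⟨u, hu, huQ⟩ := hQU v hv
      exact ⟨u, Finset.mem_union_right _ hu, Finset.mem_union_left _ huQ⟩
  refine ⟨Y, T₀ ∪ U ∪ I.biUnion fun v => Q v ∪ S v, I, fun y hy => hxr y (hYT hy), hnet, hT₂,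
    fun u hu => ?_, ?_, ?_, fun v hv => ⟨(hIt v hv).1, ?_⟩, ?_, ?_⟩
  · rcases Finset.mem_union.1 hu with hu | hu
    · rcases Finset.mem_union.1 hu with hu | hu
      exacts [hxr u hu, hUr u hu]
    · obtain ⟨v, hv, huv⟩ := Finset.mem_biUnion.1 hu
      obtain ⟨w, hwU, hwQ⟩ := hQU v hv
      have hvr : H.Reachable x v :=
        (hUr w hwU).trans (((hQc v hv).2 w hwQ v (hvQ v hv)).mono within_le)
      refine hvr.trans ?_
      rcases Finset.mem_union.1 huv with hu | hu
      · exact ((hQc v hv).2 v (hvQ v hv) u hu).mono within_le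
      · exact reachable_of_mem_ballSet (hB v (hIt v hv).1 u ((hS v (hIt v hv).1).2.1 hu))
  · exact hYT.trans (Finset.subset_union_left.trans Finset.subset_union_left)
  · have h1 : (P x) ⊆ T₀ ∪ U ∪ I.biUnion fun v => Q v ∪ S v :=
      (Finset.subset_biUnion_of_mem P hxY).trans
        (Finset.subset_union_right.trans Finset.subset_union_left)
    have h2 := Finset.card_le_card h1
    rw [hPcard x hxY] at h2
    omega
  · exact Finset.subset_union_right.trans' ((Finset.subset_biUnion_of_mem
      (fun v => Q v ∪ S v) hv).trans' Finset.subset_union_right)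
  · intro v hv w hw hvw
    have := hI'd (by simpa [hI] using hv) (by simpa [hI] using hw) hvw
    exact Finset.disjoint_coe.1 this
  · have h1 := Finset.card_union_le (T₀ ∪ U) (I.biUnion fun v => Q v ∪ S v)
    have h2 := Finset.card_union_le T₀ U
    have h3 : (I.biUnion fun v => Q v ∪ S v).card ≤ ∑ v ∈ I, (r v + 1 + (S v).card) :=
      Finset.card_biUnion_le.trans (Finset.sum_le_sum fun v hv =>
        (Finset.card_union_le _ _).trans (by have := hQcard v hv; omega))
    have h4 : ∑ v ∈ I, (r v + 1 + (S v).card) ≤ ∑ v ∈ I, (2 * r v + (S v).card) :=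
      Finset.sum_le_sum fun v hv => by have := (hr v (hIt v hv).1).1; omega
    -- The net's connecting set costs at most `(12R+1)|Y| ≤ 14|U|`. Thus `T₀ ∪ U` is charged `15·11
    -- = 165` per unit of radius, and the paths `Q v` add `r v + 1 ≤ 2 * r v`, giving 167.
    have h5 : T₀.card + U.card ≤ 15 * U.card := by
      have : (12 * R + 1) * Y.card ≤ 14 * (Y.card * (R + 1)) := by nlinarith
      omega
    have h6 : 15 * U.card ≤ ∑ v ∈ I, 165 * r v := by
      calc 15 * U.card ≤ 15 * ∑ v ∈ I, 11 * r v := Nat.mul_le_mul_left _ hUsum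
        _ = ∑ v ∈ I, 165 * r v := by
          rw [Finset.mul_sum]; exact Finset.sum_congr rfl fun v _ => by ring
    calc _ ≤ ∑ v ∈ I, 165 * r v + ∑ v ∈ I, (2 * r v + (S v).card) := by omega
      _ = _ := by rw [← Finset.sum_add_distrib]; exact Finset.sum_congr rfl fun v _ => by ring

end Skeleton

/-! ### From a nontrivial component to an expanding set. -/

section Component

variable {V : Type*} [Fintype V] {G : SimpleGraph V}

/-- The starting size `s = ⌊(D/A)^L⌋` is the largest for which a ball above `D^L` must expand.
Bernoulli's inequality makes it at least of order `Lμ`, so that radii can be charged to the sets `S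
v`. -/
lemma floor_pow_bounds {A D μ : ℝ} (hA : 1 ≤ A) (hμ : 0 < μ) (hAD : 1 + μ / 3 ≤ D / A) (L : ℕ) :
    1 ≤ ⌊(D / A) ^ L⌋₊ ∧ L * μ / 3 ≤ ⌊(D / A) ^ L⌋₊ ∧ ⌊(D / A) ^ L⌋₊ * A ^ L ≤ D ^ L := by
  have hx : 1 ≤ D / A := by linarith
  have h1 : (1 : ℝ) ≤ (D / A) ^ L := one_le_pow₀ hx
  have h2 : 1 + L * (μ / 3) ≤ (D / A) ^ L :=
    (one_add_mul_le_pow (by linarith) L).trans (pow_le_pow_left₀ (by positivity) hAD L)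
  have h3 := Nat.lt_floor_add_one ((D / A) ^ L)
  refine ⟨Nat.le_floor (by simpa using h1), by linarith, ?_⟩
  have h4 := Nat.floor_le (zero_le_one.trans h1)
  calc (⌊(D / A) ^ L⌋₊ : ℝ) * A ^ L ≤ (D / A) ^ L * A ^ L :=
        mul_le_mul_of_nonneg_right h4 (by positivity)
    _ = D ^ L := by rw [← mul_pow, div_mul_cancel₀ _ (by positivity)]

/-- A vertex of positive radius is surrounded by an expanding set. -/
lemma exists_local_expanding {A D μ : ℝ} (hA : 1 ≤ A) (hD : 1 < D) (hμ : 0 < μ)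
    (hAD : 1 + μ / 3 ≤ D / A) {v : V} (hv : 0 < radius G D v) :
    ∃ S ⊆ ball G v (radius G D v - 1), v ∈ S ∧ IsConn G S ∧
      closedNbhd G S ⊆ ball G v (radius G D v) ∧ A * S.card < (closedNbhd G S).card ∧
      (radius G D v - 1 : ℕ) * μ / 3 ≤ S.card ∧
      (D / A) ^ (radius G D v - 1) < S.card + 1 := by
  obtain ⟨L, hL, hrad, hheavy⟩ := exists_eq_radius_of_pos hD hv
  obtain ⟨h1, h2, h3⟩ := floor_pow_bounds hA hμ hAD L
  obtain ⟨S, hS, hvS, hconn, hcard, hexp⟩ :=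
    exists_expanding_subset_ball hA h1 (h3.trans_lt hheavy)
  have h5 : (⌊(D / A) ^ L⌋₊ : ℝ) ≤ S.card := by exact_mod_cast hcard
  have h6 : radius G D v - 1 = L := by omega
  rw [h6, hrad]
  refine ⟨S, hS, hvS, hconn, ?_, hexp, h2.trans h5, ?_⟩
  · intro u hu
    rcases mem_closedNbhd.1 hu with h | ⟨w, hw, hwu⟩
    · exact mem_ball.2 (ballSet_mono (by omega) (mem_ball.1 (hS h)))
    · exact mem_ball.2 (mem_ballSet_trans (mem_ball.1 (hS hw)) (mem_ballSet_of_adj hwu))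
  · have := Nat.lt_floor_add_one ((D / A) ^ L)
    linarith

/-- A union of expanding sets with disjoint closed neighbourhoods is expanding. -/
lemma isExpanding_of_skeleton [DecidableEq V] {A μ : ℝ} (hμ : 0 < μ) (hμ1 : μ ≤ 1)
    {T I : Finset V} {S B : V → Finset V} {r : V → ℕ} (hT : IsConn G T)
    (hST : ∀ v ∈ I, S v ⊆ T)
    (hSB : ∀ v ∈ I, closedNbhd G (S v) ⊆ B v)
    (hexp : ∀ v ∈ I, A * (S v).card < (closedNbhd G (S v)).card)
    (hd : ∀ v ∈ I, ∀ w ∈ I, v ≠ w → Disjoint (B v) (B w))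
    (hr : ∀ v ∈ I, (r v : ℝ) * μ ≤ 6 * (S v).card)
    (hcard : T.card ≤ ∑ v ∈ I, (167 * r v + (S v).card)) :
    IsExpanding G (μ / 1100) A T := by
  have hnd : ∀ v ∈ I, ∀ w ∈ I, v ≠ w → Disjoint (closedNbhd G (S v)) (closedNbhd G (S w)) :=
    fun v hv w hw hvw => Finset.disjoint_of_subset_left (hSB v hv)
      (Finset.disjoint_of_subset_right (hSB w hw) (hd v hv w hw hvw))
  have hsd : ∀ v ∈ I, ∀ w ∈ I, v ≠ w → Disjoint (S v) (S w) := fun v hv w hw hvw =>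
    Finset.disjoint_of_subset_left (fun u hu => mem_closedNbhd.2 (Or.inl hu))
      (Finset.disjoint_of_subset_right (fun u hu => mem_closedNbhd.2 (Or.inl hu))
        (hnd v hv w hw hvw))
  have hS : (I.biUnion S).card = ∑ v ∈ I, (S v).card := Finset.card_biUnion hsd
  have hI : I.Nonempty := by
    by_contra h
    rw [Finset.not_nonempty_iff_eq_empty] at h
    have := Finset.card_pos.2 hT.1
    rw [h, Finset.sum_empty] at hcard
    omega
  refine ⟨hT, I.biUnion S, Finset.biUnion_subset.2 hST, ?_, ?_⟩
  · rw [hS]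
    have h1 : (T.card : ℝ) ≤ ∑ v ∈ I, (167 * (r v : ℝ) + (S v).card) := by exact_mod_cast hcard
    push_cast
    calc μ / 1100 * (T.card : ℝ) ≤ μ / 1100 * ∑ v ∈ I, (167 * (r v : ℝ) + (S v).card) :=
          mul_le_mul_of_nonneg_left h1 (by positivity)
      _ = ∑ v ∈ I, μ / 1100 * (167 * (r v : ℝ) + (S v).card) := Finset.mul_sum _ _ _
      _ ≤ ∑ v ∈ I, ((S v).card : ℝ) := by
          -- Here `167 r μ ≤ 1002|S v|` and `μ|S v| ≤ |S v|`, so 1100 exceeds the needed 1003.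
          refine Finset.sum_le_sum fun v hv => ?_
          have h2 := hr v hv
          have h3 : μ * (S v).card ≤ 1 * (S v).card :=
            mul_le_mul_of_nonneg_right hμ1 (Nat.cast_nonneg _)
          nlinarith
  · have h1 : I.biUnion (fun v => closedNbhd G (S v)) ⊆ closedNbhd G (I.biUnion S) := by
      intro u hu
      obtain ⟨v, hv, hu⟩ := Finset.mem_biUnion.1 hu
      rcases mem_closedNbhd.1 hu with h | ⟨w, hw, hwu⟩
      · exact mem_closedNbhd.2 (Or.inl (Finset.mem_biUnion.2 ⟨v, hv, h⟩))
      · exact mem_closedNbhd.2 (Or.inr ⟨w, Finset.mem_biUnion.2 ⟨v, hv, hw⟩, hwu⟩)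
    have h2 := Finset.card_le_card h1
    rw [Finset.card_biUnion hnd] at h2
    have h3 : (∑ v ∈ I, ((closedNbhd G (S v)).card : ℝ)) ≤ (closedNbhd G (I.biUnion S)).card := by
      exact_mod_cast h2
    refine lt_of_lt_of_le ?_ h3
    rw [hS]
    push_cast
    rw [Finset.mul_sum]
    exact Finset.sum_lt_sum_of_nonempty hI hexp

/-- Every nontrivial component of the excision contains an expanding set controlling its size. -/
lemma exists_expanding_of_component {A D μ : ℝ} (hA : 1 ≤ A) (hD : 2 ≤ D) (hμ : 0 < μ)
    (hμ1 : μ ≤ 1) (hAD : 1 + μ / 3 ≤ D / A) {x z : V} (hxz : (excision G D).Adj x z) :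
    ∃ (T : Finset V) (R : ℕ), IsExpanding G (μ / 1100) A T ∧
      (∀ u ∈ T, (excision G D).Reachable x u) ∧ 1 ≤ R ∧ R ≤ 2 * T.card ∧
      (D / A) ^ (R - 1) < T.card + 1 ∧
      ∀ C : Finset V, (∀ u ∈ C, (excision G D).Reachable x u) →
        (C.card : ℝ) ≤ T.card * D ^ (12 * R) := by
  classical
  have hD1 : 1 < D := by linarith
  set H := excision G D with hH
  set c : Finset V := Finset.univ.filter fun v => 0 < radius G D v ∧ H.Reachable x v with hc
  have hball : ∀ v, ∀ u ∈ ball G v (radius G D v), u ∈ ballSet H v (radius G D v) := fun v u hu =>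
    ballSet_subset_ballSet_excision le_rfl (mem_ball.1 hu)
  have hcover : ∀ u, H.Reachable x u → ∃ v ∈ (c : Set V), u ∈ ball G v (radius G D v) := by
    intro u hu
    obtain ⟨w, huw⟩ : ∃ w, H.Adj u w := by
      obtain ⟨p⟩ := hu.symm
      cases p with
      | nil => exact ⟨z, hxz⟩
      | cons h _ => exact ⟨_, h⟩
    obtain ⟨v, hv, huv⟩ := exists_center_of_adj_excision huw
    have := reachable_of_mem_ballSet (hball v u (mem_ball.2 huv))
    exact ⟨v, by simpa [hc] using ⟨hv, hu.trans this.symm⟩, mem_ball.2 huv⟩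
  obtain ⟨v₁, hv₁c, -⟩ := hcover x (SimpleGraph.Reachable.refl _)
  obtain ⟨v₀, hv₀c, hmax⟩ := Finset.exists_max_image c (radius G D) ⟨v₁, hv₁c⟩
  obtain ⟨hv₀, hxv₀⟩ := (Finset.mem_filter.1 hv₀c).2
  obtain ⟨L, hL, hRL, hheavy⟩ := exists_eq_radius_of_pos hD1 hv₀
  have hrad : ∀ v, H.Reachable x v → radius G D v ≤ L + 1 := by
    intro v hv
    rcases Nat.eq_zero_or_pos (radius G D v) with h | h
    · omega
    · rw [← hRL]
      exact hmax v (Finset.mem_filter.2 ⟨Finset.mem_univ _, h, hv⟩)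
  have hpos : ∀ v ∈ c, 0 < radius G D v := fun v hv => (Finset.mem_filter.1 hv).2.1
  choose! S hSb hvS hSc hSn hSe hSs hSx using
    fun v (hv : v ∈ c) => exists_local_expanding hA hD1 hμ hAD (hpos v hv)
  -- All radii in the component are at most `L+1`, so its balls of radius `12(L+1)` are light in
  -- `G`, and those of the subgraph are no larger.
  have hballcard : ∀ y, H.Reachable x y → ((ball H y (12 * (L + 1))).card : ℝ) ≤
      D ^ (12 * (L + 1)) := by
    intro y hy
    refine le_trans ?_ (card_ball_le_of_radius_le hD1 (G := G) (v := y)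
      (by have := hrad y hy; omega))
    have hsub : ball H y (12 * (L + 1)) ⊆ ball G y (12 * (L + 1)) := fun u hu =>
      mem_ball.2 (ballSet_mono_graph excision_le (mem_ball.1 hu))
    exact_mod_cast Finset.card_le_card hsub
  have hSr : ∀ v ∈ c, ∀ u ∈ S v, H.Reachable v u := fun v hv u hu =>
    reachable_of_mem_ballSet (hball v u (mem_ball.2 (ballSet_mono (by omega)
      (mem_ball.1 (hSb v hv hu)))))
  have hDpos : (1 : ℝ) ≤ D ^ (12 * (L + 1)) := one_le_pow₀ hD1.le
  have hLr : radius G D v₀ - 1 = L := by omega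
  have hS₀s := hSs v₀ hv₀c
  have hS₀x := hSx v₀ hv₀c
  have hS₀b := hSb v₀ hv₀c
  rw [hLr] at hS₀s hS₀x hS₀b
  rcases exists_skeleton (G := G) (H := H) excision_le x (R := L + 1) (by omega) (radius G D)
    (fun v => ball G v (radius G D v)) S c
    (fun v hv => ⟨hpos v hv, hrad v (Finset.mem_filter.1 hv).2.2⟩)
    (fun v hv => ⟨hvS v hv, fun u hu => mem_ball.2 (ballSet_mono (by omega)
      (mem_ball.1 (hSb v hv hu))), hSc v hv⟩)
    (fun v _ => hball v) hcover with
    ⟨y, hxy, hy⟩ | ⟨Y, T, I, hYr, hYnet, hT, hTr, hYT, hRT, hI, hd, hcard⟩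
  · have hLle : L ≤ (ball G v₀ L).card := by
      have h1 : (L : ℝ) ≤ D ^ L := by
        calc (L : ℝ) ≤ 2 ^ L := by exact_mod_cast Nat.lt_two_pow_self.le
          _ ≤ D ^ L := pow_le_pow_left₀ zero_le_two hD L
      exact_mod_cast h1.trans hheavy.le
    have hbc : IsConn G (ball G v₀ L) := isConn_of_ballSet_subset (i := L) (v := v₀)
      (fun u hu => mem_ball.2 hu) fun u hu => ballSet_mono (by omega) (mem_ball.1 hu)
    -- In a narrow component `S v₀` alone expands. It is padded inside its heavy ball to at least
    -- `L` vertices to secure `R = L+1 ≤ 2|T|`; the bound `Lμ/3 ≤ |S v₀|` keeps the density.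
    obtain ⟨T, hST, hTb, hTc, hTcard⟩ := (hSc v₀ hv₀c).exists_superset_card hbc hS₀b
      (le_max_left _ L) (max_le (Finset.card_le_card hS₀b) hLle)
    have hT1 : (S v₀).card ≤ T.card := Finset.card_le_card hST
    have hT2 : L ≤ T.card := hTcard ▸ le_max_right _ _
    refine ⟨T, L + 1, ⟨hTc, S v₀, hST, ?_, hSe v₀ hv₀c⟩, fun u hu => ?_, by omega, by omega, ?_, ?_⟩
    · rw [hTcard]
      rcases max_choice (S v₀).card L with h | h <;> rw [h]
      · nlinarith [Nat.cast_nonneg (α := ℝ) (S v₀).card]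
      · nlinarith [Nat.cast_nonneg (α := ℝ) L, mul_nonneg (Nat.cast_nonneg (α := ℝ) L) hμ.le]
    · exact hxv₀.trans (reachable_of_mem_ballSet (ballSet_subset_ballSet_excision (j := L)
        (by omega) (mem_ball.1 (hTb hu))))
    · rw [Nat.add_sub_cancel]
      have : ((S v₀).card : ℝ) ≤ T.card := by exact_mod_cast hT1
      linarith
    · intro C hC
      have hsub : C ⊆ ball H y (12 * (L + 1)) := fun u hu => mem_ball.2 (hy u (hC u hu))
      have h1 : (C.card : ℝ) ≤ (ball H y (12 * (L + 1))).card := by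
        exact_mod_cast Finset.card_le_card hsub
      have h2 : (1 : ℝ) ≤ T.card := by exact_mod_cast Finset.card_pos.2 hTc.1
      exact (h1.trans (hballcard y hxy)).trans (le_mul_of_one_le_left (by positivity) h2)
  · have hCle : ∀ C : Finset V, (∀ u ∈ C, H.Reachable x u) →
        (C.card : ℝ) ≤ T.card * D ^ (12 * (L + 1)) := by
      intro C hC
      have h1 : C ⊆ Y.biUnion fun y => ball H y (12 * (L + 1)) := by
        intro u hu
        obtain ⟨y, hy, huy⟩ := hYnet u (hC u hu)
        exact Finset.mem_biUnion.2 ⟨y, hy, mem_ball.2 huy⟩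
      have h2 : (C.card : ℝ) ≤ ∑ y ∈ Y, ((ball H y (12 * (L + 1))).card : ℝ) := by
        exact_mod_cast (Finset.card_le_card h1).trans Finset.card_biUnion_le
      refine (h2.trans (Finset.sum_le_card_nsmul _ _ _ fun y hy => hballcard y (hYr y hy))).trans ?_
      rw [nsmul_eq_mul]
      exact mul_le_mul_of_nonneg_right (by exact_mod_cast Finset.card_le_card hYT) (by positivity)
    -- If the skeleton is too small for the logarithmic bound on the radius, then `|T| ≤ |S v₀|` and
    -- `S v₀` serves instead.
    by_cases hx : (D / A) ^ L < T.card + 1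
    · refine ⟨T, L + 1, ?_, hTr, by omega, by omega, by rwa [Nat.add_sub_cancel], hCle⟩
      refine isExpanding_of_skeleton hμ hμ1 hT (fun v hv => (hI v hv).2)
        (fun v hv => hSn v (hI v hv).1) (fun v hv => hSe v (hI v hv).1) hd (fun v hv => ?_) hcard
      have h1 := hSs v (hI v hv).1
      obtain ⟨M, hM1, hM, -⟩ := exists_eq_radius_of_pos hD1 (hpos v (hI v hv).1)
      rw [hM, Nat.add_sub_cancel] at h1
      rw [hM]
      have h2 : (1 : ℝ) ≤ M := by exact_mod_cast hM1
      push_cast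
      nlinarith
    · have h1 : T.card ≤ (S v₀).card := by
        have : (T.card : ℝ) < (S v₀).card + 1 := by linarith
        exact Nat.lt_succ_iff.1 (by exact_mod_cast this)
      refine ⟨S v₀, L + 1, ⟨hSc v₀ hv₀c, S v₀, subset_rfl, ?_, hSe v₀ hv₀c⟩,
        fun u hu => hxv₀.trans (hSr v₀ hv₀c u hu), by omega, by omega,
        by rwa [Nat.add_sub_cancel], fun C hC => (hCle C hC).trans ?_⟩
      · nlinarith [Nat.cast_nonneg (α := ℝ) (S v₀).card]
      · exact mul_le_mul_of_nonneg_right (by exact_mod_cast h1) (by positivity)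

end Component

/-! ### Sparsity of expanding sets and its consequences. -/

section Sparse

variable {n : ℕ}

/-- Expanding sets of each size are rare: there are at most `n * ρ ^ k` disjoint ones of size `k`. -/
def IsSparse (G : SimpleGraph (Fin n)) (θ A ρ : ℝ) : Prop :=
  ∀ k, ¬ HasDisjointExpanding G θ A (k + 1) (⌊n * ρ ^ (k + 1)⌋₊ + 1)

lemma exists_expanding_of_nontrivial {G : SimpleGraph (Fin n)} {A D μ : ℝ} (hA : 1 ≤ A)
    (hD : 2 ≤ D) (hμ : 0 < μ) (hμ1 : μ ≤ 1) (hAD : 1 + μ / 3 ≤ D / A)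
    (C : (excision G D).ConnectedComponent) (hC : 1 < C.supp.ncard) :
    ∃ (T : Finset (Fin n)) (R : ℕ), IsExpanding G (μ / 1100) A T ∧
      (∀ u ∈ T, u ∈ C.supp) ∧ 1 ≤ R ∧ R ≤ 2 * T.card ∧
      (D / A) ^ (R - 1) < T.card + 1 ∧ (C.supp.ncard : ℝ) ≤ T.card * D ^ (12 * R) := by
  classical
  obtain ⟨x, hx, y, hy, hxy⟩ := (Set.one_lt_ncard (Set.toFinite _)).1 hC
  rw [SimpleGraph.ConnectedComponent.mem_supp_iff] at hx hy
  have hr : (excision G D).Reachable x y := SimpleGraph.ConnectedComponent.exact (hx.trans hy.symm)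
  obtain ⟨z, hz⟩ : ∃ z, (excision G D).Adj x z := by
    obtain ⟨p⟩ := hr
    cases p with
    | nil => exact absurd rfl hxy
    | cons h _ => exact ⟨_, h⟩
  obtain ⟨T, R, h1, h2, h3, h4, h5, h6⟩ :=
    exists_expanding_of_component hA hD hμ hμ1 hAD hz
  have hmem : ∀ u, (excision G D).Reachable x u ↔ u ∈ C.supp := by
    intro u
    rw [SimpleGraph.ConnectedComponent.mem_supp_iff, ← hx,
      SimpleGraph.ConnectedComponent.eq]
    exact ⟨fun h => h.symm, fun h => h.symm⟩
  refine ⟨T, R, h1, fun u hu => (hmem u).1 (h2 u hu), h3, h4, h5, ?_⟩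
  have := h6 C.supp.toFinset fun u hu => (hmem u).2 (Set.mem_toFinset.1 hu)
  rwa [← Set.ncard_eq_toFinset_card'] at this

lemma card_le_of_isSparse {G : SimpleGraph (Fin n)} {θ A ρ : ℝ} (hρ : 0 ≤ ρ)
    (h : IsSparse G θ A ρ)
    {k : ℕ} (hk : 1 ≤ k) (𝒯 : Finset (Finset (Fin n)))
    (hd : ∀ S ∈ 𝒯, ∀ T ∈ 𝒯, S ≠ T → Disjoint S T)
    (hT : ∀ T ∈ 𝒯, T.card = k ∧ IsExpanding G θ A T) : (𝒯.card : ℝ) ≤ n * ρ ^ k := by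
  obtain ⟨k, rfl⟩ := Nat.exists_eq_add_of_le' hk
  by_contra hcon
  have h0 : 0 ≤ n * ρ ^ (k + 1) := by positivity
  have h1 : ⌊n * ρ ^ (k + 1)⌋₊ + 1 ≤ 𝒯.card := (Nat.floor_lt h0).2 (not_le.1 hcon)
  obtain ⟨𝒮, hsub, hcard⟩ := Finset.exists_subset_card_eq h1
  exact h k ⟨𝒮, hcard, fun S hS T hT => hd S (hsub hS) T (hsub hT), fun T hT' => hT T (hsub hT')⟩

/-- Components are grouped by witness size `k`. There are at most `nρ^k` of them, as their witnesses
are disjoint, each with `|C|² ≤ (D^k·D^(24k))² = D^(50k)`; the sum is geometric. -/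
lemma sumSqNontrivial_le {G : SimpleGraph (Fin n)} {A D μ ρ : ℝ} (hA : 1 ≤ A)
    (hD : 2 ≤ D) (hμ : 0 < μ) (hμ1 : μ ≤ 1) (hAD : 1 + μ / 3 ≤ D / A) (hρ : 0 ≤ ρ)
    (hρD : ρ * D ^ 50 ≤ 1 / 2) (h : IsSparse G (μ / 1100) A ρ) :
    sumSqNontrivial (excision G D) ≤ 2 * (ρ * D ^ 50) * n := by
  classical
  choose! T R hT hTC hR hRT hexp hcard using fun (C : (excision G D).ConnectedComponent)
    (hC : 1 < C.supp.ncard) => exists_expanding_of_nontrivial hA hD hμ hμ1 hAD C hC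
  set 𝒞 := (Finset.univ : Finset (excision G D).ConnectedComponent).filter
    fun C => 1 < C.supp.ncard with h𝒞
  have hmem : ∀ C ∈ 𝒞, 1 < C.supp.ncard := fun C hC => (Finset.mem_filter.1 hC).2
  have hpos : ∀ C ∈ 𝒞, 1 ≤ (T C).card := fun C hC => Finset.card_pos.2 (hT C (hmem C hC)).1.1
  have hD1 : 1 ≤ D := by linarith
  have hsq : ∀ C ∈ 𝒞, (C.supp.ncard : ℝ) ^ 2 ≤ (D ^ 50) ^ (T C).card := by
    intro C hC
    have h1 := hcard C (hmem C hC)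
    have h2 : ((T C).card : ℝ) ≤ D ^ (T C).card := by
      calc ((T C).card : ℝ) ≤ 2 ^ (T C).card := by exact_mod_cast Nat.lt_two_pow_self.le
        _ ≤ D ^ (T C).card := pow_le_pow_left₀ zero_le_two hD _
    have h3 : D ^ (12 * R C) ≤ D ^ (24 * (T C).card) :=
      pow_le_pow_right₀ hD1 (by have := hRT C (hmem C hC); omega)
    calc (C.supp.ncard : ℝ) ^ 2 ≤ (D ^ (T C).card * D ^ (24 * (T C).card)) ^ 2 := by
          refine pow_le_pow_left₀ (Nat.cast_nonneg _) (h1.trans ?_) 2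
          exact mul_le_mul h2 h3 (by positivity) (by positivity)
      _ = (D ^ 50) ^ (T C).card := by
          rw [← pow_add, ← pow_mul, ← pow_mul]
          congr 1
          ring
  have hfib : ∀ k, 1 ≤ k → ((𝒞.filter fun C => (T C).card = k).card : ℝ) ≤ n * ρ ^ k := by
    intro k hk
    have hdis : ∀ C ∈ 𝒞, ∀ C' ∈ 𝒞, C ≠ C' → Disjoint (T C) (T C') := by
      intro C hC C' hC' hne
      rw [Finset.disjoint_left]
      intro u hu hu'
      exact hne ((hTC C (hmem C hC) u hu).symm.trans (hTC C' (hmem C' hC') u hu'))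
    have hinj : Set.InjOn T (𝒞.filter fun C => (T C).card = k) := by
      intro C hC C' hC' heq
      have hC := (Finset.mem_filter.1 hC).1
      have hC' := (Finset.mem_filter.1 hC').1
      by_contra hne
      have := hdis C hC C' hC' hne
      rw [← heq, disjoint_self] at this
      exact (Finset.card_pos.1 (hpos C hC)).ne_empty this
    rw [← Finset.card_image_of_injOn hinj]
    refine card_le_of_isSparse hρ h hk _ ?_ ?_
    · intro S hS S' hS' hne
      obtain ⟨C, hC, rfl⟩ := Finset.mem_image.1 hS
      obtain ⟨C', hC', rfl⟩ := Finset.mem_image.1 hS'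
      exact hdis C (Finset.mem_filter.1 hC).1 C' (Finset.mem_filter.1 hC').1
        fun h => hne (congrArg T h)
    · intro S hS
      obtain ⟨C, hC, rfl⟩ := Finset.mem_image.1 hS
      obtain ⟨hC1, hC2⟩ := Finset.mem_filter.1 hC
      exact ⟨hC2, hT C (hmem C hC1)⟩
  have hx0 : 0 ≤ ρ * D ^ 50 := by positivity
  calc sumSqNontrivial (excision G D) = ∑ C ∈ 𝒞, (C.supp.ncard : ℝ) ^ 2 := by
        rw [sumSqNontrivial, h𝒞]
        congr!
    _ ≤ ∑ C ∈ 𝒞, (D ^ 50) ^ (T C).card := Finset.sum_le_sum hsq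
    _ = ∑ k ∈ Finset.range n, ∑ C ∈ 𝒞 with (T C).card - 1 = k, (D ^ 50) ^ (T C).card := by
        refine (Finset.sum_fiberwise_of_maps_to (fun C hC => ?_) _).symm
        have h1 := hpos C hC
        have h2 := Finset.card_le_univ (T C)
        rw [Fintype.card_fin] at h2
        exact Finset.mem_range.2 (by omega)
    _ ≤ ∑ k ∈ Finset.range n, n * ((ρ * D ^ 50) * (1 / 2) ^ k) := by
        refine Finset.sum_le_sum fun k _ => ?_
        have h1 : (𝒞.filter fun C => (T C).card - 1 = k) =
            𝒞.filter fun C => (T C).card = k + 1 :=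
          Finset.filter_congr fun C hC => by have := hpos C hC; omega
        rw [h1, Finset.sum_congr rfl (g := fun _ => (D ^ 50) ^ (k + 1))
          fun C hC => by rw [(Finset.mem_filter.1 hC).2], Finset.sum_const, nsmul_eq_mul]
        calc _ ≤ (n * ρ ^ (k + 1)) * (D ^ 50) ^ (k + 1) :=
              mul_le_mul_of_nonneg_right (hfib (k + 1) (by omega)) (by positivity)
          _ = n * ((ρ * D ^ 50) * (ρ * D ^ 50) ^ k) := by
              rw [mul_assoc, ← mul_pow, pow_succ']
          _ ≤ _ := by gcongr
    _ = n * (ρ * D ^ 50) * ∑ k ∈ Finset.range n, (1 / 2 : ℝ) ^ k := by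
        rw [Finset.mul_sum]
        exact Finset.sum_congr rfl fun k _ => by ring
    _ ≤ n * (ρ * D ^ 50) * 2 :=
        mul_le_mul_of_nonneg_left (sum_geometric_two_le n) (by positivity)
    _ = _ := by ring

/-- In a sparse graph the expanding sets have logarithmic size. -/
lemma mul_card_le_log {G : SimpleGraph (Fin n)} {θ A s : ℝ}
    (h : IsSparse G θ A (Real.exp (-s))) {T : Finset (Fin n)} (hT : IsExpanding G θ A T) :
    s * T.card ≤ Real.log n := by
  classical
  have h1 := card_le_of_isSparse (Real.exp_pos _).le h (Finset.card_pos.2 hT.1.1) {T}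
    (by
      intro S hS S' hS' hne
      exact absurd ((Finset.mem_singleton.1 hS).trans (Finset.mem_singleton.1 hS').symm) hne)
    (by
      intro S hS
      rw [Finset.mem_singleton.1 hS]
      exact ⟨rfl, hT⟩)
  rw [Finset.card_singleton, Nat.cast_one, ← Real.exp_nat_mul] at h1
  have hn : (0 : ℝ) < n := by
    by_contra hn
    have h0 : (n : ℝ) = 0 := le_antisymm (not_lt.1 hn) (Nat.cast_nonneg n)
    rw [h0] at h1
    linarith
  have h2 := Real.log_le_log one_pos h1
  rw [Real.log_one, Real.log_mul hn.ne' (Real.exp_pos _).ne', Real.log_exp] at h2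
  linarith

/-- Bound for the probability that expanding sets are not rare. -/
def sparseTail (s : ℝ) (n : ℕ) : ℝ :=
  ∑' k : ℕ, Real.exp (-((k + 1) * (⌊n * Real.exp (-s) ^ (k + 1)⌋₊ + 1 : ℝ)))

lemma exp_neg_mul_le (k : ℕ) {m : ℝ} (hm : 0 ≤ m) :
    Real.exp (-((k + 1) * (m + 1))) ≤ Real.exp (-1) ^ (k + 1) := by
  rw [← Real.exp_nat_mul]
  refine Real.exp_le_exp.2 ?_
  push_cast
  nlinarith [Nat.cast_nonneg (α := ℝ) k, mul_nonneg (Nat.cast_nonneg (α := ℝ) k) hm]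

lemma summable_exp_neg_one : Summable fun k : ℕ => Real.exp (-1) ^ (k + 1) :=
  (summable_nat_add_iff 1).2 (summable_geometric_of_lt_one (Real.exp_pos _).le
    ((Real.exp_lt_exp.2 (by norm_num)).trans_eq Real.exp_zero))

/-- For fixed `k` the floor tends to infinity; the `+1` in the exponent supplies the summable
majorant `exp(-(k+1))` uniformly in `n`. -/
lemma tendsto_sparseTail (s : ℝ) : Tendsto (sparseTail s) atTop (𝓝 0) := by
  have h := tendsto_tsum_of_dominated_convergence (𝓕 := (atTop : Filter ℕ))
    (f := fun n k : ℕ => Real.exp (-((k + 1) * (⌊n * Real.exp (-s) ^ (k + 1)⌋₊ + 1 : ℝ))))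
    (g := fun _ => (0 : ℝ)) summable_exp_neg_one (fun k => ?_)
    (Eventually.of_forall fun n k => ?_)
  · rw [tsum_zero] at h
    exact h
  · refine Real.tendsto_exp_neg_atTop_nhds_zero.comp ?_
    refine Tendsto.const_mul_atTop (by positivity) (tendsto_atTop_add_const_right _ _ ?_)
    refine tendsto_natCast_atTop_atTop.comp (tendsto_nat_floor_atTop.comp ?_)
    exact tendsto_natCast_atTop_atTop.atTop_mul_const (by positivity)
  · rw [Real.norm_of_nonneg (Real.exp_pos _).le]
    exact exp_neg_mul_le k (Nat.cast_nonneg _)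

/-- The threshold `m` exceeds the mean `Nq` by the factor `exp(s(k+1))`, which defeats the `e^m`
from `m^m/m!`. This is why `q` must decay at twice the rate `s`. -/
lemma pow_div_factorial_le {N q s : ℝ} {k m : ℕ} (hN : 0 ≤ N) (hq0 : 0 ≤ q) (hs : 2 ≤ s)
    (hq : q ≤ Real.exp (-(2 * s) * (k + 1))) (hm : N * Real.exp (-s) ^ (k + 1) ≤ m) :
    (N * q) ^ m / m.factorial ≤ Real.exp (-((k + 1) * m)) := by
  have h1 : N * q ≤ m * Real.exp (-s * (k + 1)) := by
    calc N * q ≤ N * Real.exp (-(2 * s) * (k + 1)) := mul_le_mul_of_nonneg_left hq hN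
      _ = (N * Real.exp (-s) ^ (k + 1)) * Real.exp (-s * (k + 1)) := by
          rw [mul_assoc, ← Real.exp_nat_mul, ← Real.exp_add]
          congr 2
          push_cast
          ring
      _ ≤ _ := mul_le_mul_of_nonneg_right hm (Real.exp_pos _).le
  calc (N * q) ^ m / m.factorial ≤ (m * Real.exp (-s * (k + 1))) ^ m / m.factorial := by
        gcongr
    _ = (m : ℝ) ^ m / m.factorial * Real.exp (-s * (k + 1)) ^ m := by rw [mul_pow]; ring
    _ ≤ Real.exp m * Real.exp (-s * (k + 1)) ^ m := by
        gcongr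
        exact Real.pow_div_factorial_le_exp _ (Nat.cast_nonneg _) m
    _ = Real.exp (m * (1 - s * (k + 1))) := by
        rw [← Real.exp_nat_mul, ← Real.exp_add]
        congr 1
        ring
    _ ≤ _ := by
        refine Real.exp_le_exp.2 ?_
        have h2 : 1 - s * (k + 1) ≤ -((k : ℝ) + 1) := by
          nlinarith [Nat.cast_nonneg (α := ℝ) k]
        nlinarith [mul_le_mul_of_nonneg_left h2 (Nat.cast_nonneg (α := ℝ) m)]

lemma edgeMeasure_real_not_isSparse_le (p : Sym2 (Fin n) → unitInterval) {b : ℝ} (hb0 : 0 ≤ b)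
    (hb : ∀ v, ∑ w, (p s(v, w) : ℝ) ≤ b) {t a κ θ A s : ℝ} (ht : 0 ≤ t) (hκ0 : 0 ≤ κ)
    (hκ : (Real.exp (2 * t) - 1) / 2 * b - t * a ≤ -κ) (hθ : 0 < θ) (hA : 1 / θ + a ≤ A)
    (hs : 2 ≤ s)
    (hq : ∀ k : ℕ, (4 * b) ^ k * (2 ^ (k + 1) * Real.exp (-(κ * θ * (k + 1)))) ≤
      Real.exp (-(2 * s) * (k + 1))) :
    (edgeMeasure p).real {ω | ¬ IsSparse (graphOf ω) θ A (Real.exp (-s))} ≤ sparseTail s n := by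
  have hsub : {ω : Sym2 (Fin n) → Bool | ¬ IsSparse (graphOf ω) θ A (Real.exp (-s))} ⊆
      ⋃ k ∈ Finset.range n, {ω : Sym2 (Fin n) → Bool | HasDisjointExpanding (graphOf ω) θ A (k + 1)
        (⌊n * Real.exp (-s) ^ (k + 1)⌋₊ + 1)} := by
    intro ω hω
    simp only [IsSparse, not_forall, not_not, Set.mem_ofPred_eq] at hω
    obtain ⟨k, hk⟩ := hω
    refine Set.mem_iUnion₂.2 ⟨k, ?_, hk⟩
    obtain ⟨𝒯, hc, -, hT⟩ := hk
    obtain ⟨T, hT'⟩ := Finset.card_pos.1 (by omega : 0 < 𝒯.card)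
    have h1 := (hT T hT').1
    have h2 := Finset.card_le_univ T
    rw [Fintype.card_fin] at h2
    exact Finset.mem_range.2 (by omega)
  refine (measureReal_mono hsub (measure_ne_top _ _)).trans
    ((measureReal_biUnion_finset_le _ _).trans ?_)
  refine le_trans (Finset.sum_le_sum fun k _ => ?_) (Summable.sum_le_tsum (Finset.range n)
    (fun k _ => (Real.exp_pos _).le) ?_)
  · refine (edgeMeasure_real_hasDisjointExpanding_le p hb ht hκ0 hκ hθ hA k _).trans ?_
    have := pow_div_factorial_le (N := n) (m := ⌊n * Real.exp (-s) ^ (k + 1)⌋₊ + 1)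
      (Nat.cast_nonneg n) (by positivity) hs (hq k)
      (by push_cast; exact (Nat.lt_floor_add_one _).le)
    push_cast at this
    exact this
  · exact Summable.of_nonneg_of_le (fun k => (Real.exp_pos _).le)
      (fun k => exp_neg_mul_le k (Nat.cast_nonneg _)) summable_exp_neg_one

end Sparse

/-! ### The block model as a mixture over nearly balanced labellings. -/

section BlockModel

variable {n : ℕ}

lemma measurableSet_graph (E : Set (SimpleGraph (Fin n))) : MeasurableSet E := by
  refine ⟨SimpleGraph.Adj '' E, (Set.toFinite _).measurableSet, ?_⟩
  exact Set.preimage_image_eq _ fun _ _ h => SimpleGraph.ext h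

lemma sbm_real (d lam : ℝ) (E : Set (SimpleGraph (Fin n))) :
    (sbm n d lam).real E = ∑ σ : Labels n, ((2 : ℝ) ^ n)⁻¹ *
      (edgeMeasure (edgeProb d lam σ)).real {ω | graphOf ω ∈ E} := by
  have h1 : ∀ σ : Labels n, sbmGiven d lam σ E =
      edgeMeasure (edgeProb d lam σ) {ω | graphOf ω ∈ E} := fun σ =>
    Measure.map_apply measurable_graphOf (measurableSet_graph E)
  rw [measureReal_def, sbm, Measure.finsetSum_apply, ENNReal.toReal_sum]
  · refine Finset.sum_congr rfl fun σ _ => ?_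
    rw [Measure.smul_apply, h1, smul_eq_mul, ENNReal.toReal_mul, measureReal_def]
    simp
  · intro σ _
    rw [Measure.smul_apply, smul_eq_mul]
    exact ENNReal.mul_ne_top (by simp) (measure_ne_top _ _)

/-- The sign of a label as a real number. -/
def sgn (s : ℤˣ) : ℝ := ((s : ℤ) : ℝ)

lemma sgn_cases (s : ℤˣ) : sgn s = 1 ∨ sgn s = -1 := by
  rcases Int.units_eq_one_or s with rfl | rfl <;> simp [sgn]

lemma sgn_mul_self (s : ℤˣ) : sgn s * sgn s = 1 := by
  rcases sgn_cases s with h | h <;> rw [h] <;> norm_num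

lemma sum_labels_sq : ∑ σ : Labels n, (∑ u, sgn (σ u)) ^ 2 = n * 2 ^ n := by
  have hoff : ∀ u v : Fin n, u ≠ v → ∑ σ : Labels n, sgn (σ u) * sgn (σ v) = 0 := by
    intro u v huv
    -- Flipping the label of `u` alone reverses the sign of the product, so the off-diagonal sum
    -- vanishes.
    have h := Equiv.sum_comp (Equiv.mulLeft (Pi.mulSingle u (-1) : Labels n))
      fun σ : Labels n => sgn (σ u) * sgn (σ v)
    have h2 : ∀ σ : Labels n, sgn ((Equiv.mulLeft (Pi.mulSingle u (-1) : Labels n)) σ u) *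
        sgn ((Equiv.mulLeft (Pi.mulSingle u (-1) : Labels n)) σ v) =
        -(sgn (σ u) * sgn (σ v)) := by
      intro σ
      simp [sgn, Pi.mulSingle_eq_of_ne huv.symm]
    simp_rw [h2] at h
    rw [Finset.sum_neg_distrib] at h
    linarith
  have hdiag : ∀ u : Fin n, ∑ σ : Labels n, sgn (σ u) * sgn (σ u) = 2 ^ n := by
    intro u
    simp_rw [sgn_mul_self]
    simp
  simp_rw [sq, Finset.sum_mul_sum]
  rw [Finset.sum_comm]
  rw [Finset.sum_congr rfl (g := fun _ => (2 : ℝ) ^ n)]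
  · simp
  · intro u _
    rw [Finset.sum_comm, Finset.sum_eq_single u]
    · exact hdiag u
    · intro v _ hvu
      exact hoff u v hvu.symm
    · simp

/-- Few labellings are unbalanced. -/
lemma card_unbalanced_le {τ : ℝ} (hτ : 0 < τ) (hn : 0 < n) :
    ((Finset.univ.filter fun σ : Labels n => τ * n < |∑ u, sgn (σ u)|).card : ℝ) ≤
      2 ^ n * (1 / (τ ^ 2 * n)) := by
  have hn' : (0 : ℝ) < n := by exact_mod_cast hn
  set F := Finset.univ.filter fun σ : Labels n => τ * n < |∑ u, sgn (σ u)| with hF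
  have h1 : (F.card : ℝ) * (τ * n) ^ 2 ≤ n * 2 ^ n := by
    rw [← sum_labels_sq, ← nsmul_eq_mul]
    refine (Finset.card_nsmul_le_sum F (fun σ => (∑ u, sgn (σ u)) ^ 2) _ fun σ hσ => ?_).trans
      (Finset.sum_le_univ_sum_of_nonneg fun σ => sq_nonneg _)
    rw [← sq_abs (∑ u, sgn (σ u))]
    exact pow_le_pow_left₀ (by positivity) (Finset.mem_filter.1 hσ).2.le 2
  rw [mul_one_div, le_div_iff₀ (by positivity)]
  have h2 : (F.card : ℝ) * (τ ^ 2 * n) * n ≤ 2 ^ n * n := by nlinarith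
  exact le_of_mul_le_mul_right h2 hn'

lemma edgeProb_le {d lam : ℝ} (hd : 1 ≤ d) (hlam : |lam| ≤ √d) (σ : Labels n) (v w : Fin n) :
    (edgeProb d lam σ s(v, w) : ℝ) ≤ (d + lam * √d * (sgn (σ v) * sgn (σ w))) / n := by
  have hsq : √d * √d = d := Real.mul_self_sqrt (by linarith)
  have h0 : |lam * √d| ≤ d := by
    rw [abs_mul, abs_of_nonneg (Real.sqrt_nonneg d)]
    calc |lam| * √d ≤ √d * √d := mul_le_mul_of_nonneg_right hlam (Real.sqrt_nonneg d)
      _ = d := hsq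
  have h1 := abs_le.1 h0
  have hle : ∀ x : ℝ, 0 ≤ x → (Set.projIcc (0 : ℝ) 1 zero_le_one x : ℝ) ≤ x := fun x hx => by
    rw [Set.coe_projIcc]
    exact max_le hx (min_le_right _ _)
  have hval : (if ∀ u ∈ s(v, w), ∀ u' ∈ s(v, w), σ u = σ u' then (d + lam * √d) / n
      else (d - lam * √d) / n) = (d + lam * √d * (sgn (σ v) * sgn (σ w))) / n := by
    by_cases h : σ v = σ w
    · rw [if_pos, h, sgn_mul_self, mul_one]
      intro u hu u' hu'
      rcases Sym2.mem_iff.1 hu with rfl | rfl <;> rcases Sym2.mem_iff.1 hu' with rfl | rfl <;>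
        simp [h]
    · rw [if_neg fun h' => h (h' v (by simp) w (by simp))]
      have : sgn (σ v) * sgn (σ w) = -1 := by
        rcases Int.units_eq_one_or (σ v) with hv | hv <;>
          rcases Int.units_eq_one_or (σ w) with hw | hw <;> rw [hv, hw] at h ⊢ <;> simp [sgn] at h ⊢
      rw [this]
      ring
  have hnn : 0 ≤ (d + lam * √d * (sgn (σ v) * sgn (σ w))) / n := by
    refine div_nonneg ?_ (Nat.cast_nonneg n)
    have : sgn (σ v) * sgn (σ w) = 1 ∨ sgn (σ v) * sgn (σ w) = -1 := by
      rcases sgn_cases (σ v) with h | h <;> rcases sgn_cases (σ w) with h' | h' <;>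
        rw [h, h'] <;> norm_num
    rcases this with h | h <;> rw [h] <;> linarith [h1.1, h1.2]
  refine le_trans (le_of_eq ?_) (hle _ hnn)
  rw [edgeProb]
  congr 2

/-- The community term of the expected degree is proportional to the imbalance of the labelling,
with coefficient at most `d` because `|lam|√d ≤ d`. -/
lemma sum_edgeProb_le {d lam τ : ℝ} (hd : 1 ≤ d) (hlam : |lam| ≤ √d) (hn : 0 < n)
    {σ : Labels n} (hσ : |∑ u, sgn (σ u)| ≤ τ * n) (v : Fin n) :
    ∑ w, (edgeProb d lam σ s(v, w) : ℝ) ≤ d * (1 + τ) := by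
  have hn' : (0 : ℝ) < n := by exact_mod_cast hn
  have hsq : √d * √d = d := Real.mul_self_sqrt (by linarith)
  have h0 : |lam * √d| ≤ d := by
    rw [abs_mul, abs_of_nonneg (Real.sqrt_nonneg d)]
    calc |lam| * √d ≤ √d * √d := mul_le_mul_of_nonneg_right hlam (Real.sqrt_nonneg d)
      _ = d := hsq
  refine (Finset.sum_le_sum fun w _ => edgeProb_le hd hlam σ v w).trans ?_
  rw [← Finset.sum_div, div_le_iff₀ hn', Finset.sum_add_distrib, ← Finset.mul_sum,
    ← Finset.mul_sum]
  simp only [Finset.sum_const, Finset.card_univ, Fintype.card_fin, nsmul_eq_mul]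
  have h1 : lam * √d * (sgn (σ v) * ∑ w, sgn (σ w)) ≤ d * (τ * n) := by
    refine (le_abs_self _).trans ?_
    rw [abs_mul (lam * √d), abs_mul (sgn (σ v))]
    have : |sgn (σ v)| = 1 := by rcases sgn_cases (σ v) with h | h <;> rw [h] <;> simp
    rw [this, one_mul]
    exact mul_le_mul h0 hσ (abs_nonneg _) (by linarith)
  nlinarith

lemma sbm_real_not_isSparse_le {d lam τ : ℝ} (hd : 1 ≤ d) (hlam : |lam| ≤ √d) (hτ : 0 < τ)
    (hn : 0 < n) {t a κ θ A s : ℝ} (ht : 0 ≤ t) (hκ0 : 0 ≤ κ)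
    (hκ : (Real.exp (2 * t) - 1) / 2 * (d * (1 + τ)) - t * a ≤ -κ) (hθ : 0 < θ)
    (hA : 1 / θ + a ≤ A) (hs : 2 ≤ s)
    (hq : ∀ k : ℕ, (4 * (d * (1 + τ))) ^ k * (2 ^ (k + 1) * Real.exp (-(κ * θ * (k + 1)))) ≤
      Real.exp (-(2 * s) * (k + 1))) :
    (sbm n d lam).real {G | ¬ IsSparse G θ A (Real.exp (-s))} ≤
      1 / (τ ^ 2 * n) + sparseTail s n := by
  have h2 : (0 : ℝ) < 2 ^ n := by positivity
  have htail : 0 ≤ sparseTail s n := tsum_nonneg fun k => (Real.exp_pos _).le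
  rw [sbm_real, ← Finset.mul_sum, ← Finset.sum_filter_add_sum_filter_not Finset.univ
    fun σ : Labels n => τ * n < |∑ u, sgn (σ u)|]
  rw [inv_mul_le_iff₀ h2, mul_add]
  refine add_le_add ?_ ?_
  · refine le_trans ?_ (card_unbalanced_le hτ hn)
    refine (Finset.sum_le_card_nsmul _ _ 1 fun σ _ => measureReal_le_one).trans ?_
    simp
  · refine (Finset.sum_le_card_nsmul _ _ (sparseTail s n) fun σ hσ => ?_).trans ?_
    · exact edgeMeasure_real_not_isSparse_le _ (by positivity)
        (sum_edgeProb_le hd hlam hn (not_lt.1 (Finset.mem_filter.1 hσ).2)) ht hκ0 hκ hθ hA hs hq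
    · rw [nsmul_eq_mul]
      refine mul_le_mul_of_nonneg_right ?_ htail
      have h3 := Finset.card_le_univ
        (Finset.univ.filter fun σ : Labels n => ¬ τ * n < |∑ u, sgn (σ u)|)
      have h4 : Fintype.card (Labels n) = 2 ^ n := by simp
      rw [h4] at h3
      exact_mod_cast h3

lemma tendsto_sbm_isSparse {d lam τ : ℝ} (hd : 1 ≤ d) (hlam : |lam| ≤ √d) (hτ : 0 < τ)
    {t a κ θ A s : ℝ} (ht : 0 ≤ t) (hκ0 : 0 ≤ κ)
    (hκ : (Real.exp (2 * t) - 1) / 2 * (d * (1 + τ)) - t * a ≤ -κ) (hθ : 0 < θ)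
    (hA : 1 / θ + a ≤ A) (hs : 2 ≤ s)
    (hq : ∀ k : ℕ, (4 * (d * (1 + τ))) ^ k * (2 ^ (k + 1) * Real.exp (-(κ * θ * (k + 1)))) ≤
      Real.exp (-(2 * s) * (k + 1))) :
    Tendsto (fun n : ℕ => (sbm n d lam).real {G | IsSparse G θ A (Real.exp (-s))})
      atTop (𝓝 1) := by
  have h1 : Tendsto (fun n : ℕ => 1 - (1 / (τ ^ 2 * n) + sparseTail s n)) atTop (𝓝 1) := by
    have h2 : Tendsto (fun n : ℕ => 1 / (τ ^ 2 * (n : ℝ))) atTop (𝓝 0) := by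
      simp_rw [one_div]
      exact tendsto_inv_atTop_zero.comp
        (Tendsto.const_mul_atTop (by positivity) tendsto_natCast_atTop_atTop)
    simpa using (h2.add (tendsto_sparseTail s)).const_sub 1
  refine tendsto_of_tendsto_of_tendsto_of_le_of_le' h1 tendsto_const_nhds ?_
    (Eventually.of_forall fun n => measureReal_le_one)
  filter_upwards [eventually_gt_atTop 0] with n hn
  have h3 := sbm_real_not_isSparse_le hd hlam hτ hn ht hκ0 hκ hθ hA hs hq
  have h4 := probReal_compl_eq_one_sub (μ := sbm n d lam)
    (measurableSet_graph {G | IsSparse G θ A (Real.exp (-s))})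
  have h5 : {G : SimpleGraph (Fin n) | IsSparse G θ A (Real.exp (-s))}ᶜ =
    {G | ¬ IsSparse G θ A (Real.exp (-s))} := rfl
  rw [h5] at h4
  linarith

end BlockModel

/-! ### Choice of parameters and the final estimates. -/

section Parameters

/-- The only place where the cube-root hypothesis enters. For `ε ≤ 1` it is cubed directly; for `ε ≥
1` it forces `x = εd ≥ 16K²`, and `log D = O(√x)` suffices. -/
lemma mul_one_add_log_le {d ε K : ℝ} (hK : 1 ≤ K) (hd : 1 ≤ d)
    (h : 16 * K ^ 2 * ((1 + Real.log d) / d) ^ (1 / 3 : ℝ) ≤ ε) :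
    0 < ε ∧ K * (1 + Real.log (d * (1 + ε))) ≤ min (ε ^ 3) ε * d := by
  have hlog : 0 ≤ Real.log d := Real.log_nonneg hd
  have hd0 : 0 < d := by linarith
  set y := (1 + Real.log d) / d with hy
  have hy0 : 0 < y := by positivity
  have hε : 0 < ε := lt_of_lt_of_le (by positivity) h
  have hcube : (16 * K ^ 2) ^ 3 * (1 + Real.log d) ≤ ε ^ 3 * d := by
    have h1 := pow_le_pow_left₀ (by positivity) h 3
    rw [mul_pow, ← Real.rpow_natCast (y ^ (1 / 3 : ℝ)), ← Real.rpow_mul hy0.le] at h1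
    norm_num at h1
    have h2 := mul_le_mul_of_nonneg_right h1 hd0.le
    rw [hy] at h2
    have h3 : (16 * K ^ 2) ^ 3 * ((1 + Real.log d) / d) * d =
        (16 * K ^ 2) ^ 3 * (1 + Real.log d) := by field_simp
    calc _ = (16 * K ^ 2) ^ 3 * ((1 + Real.log d) / d) * d := h3.symm
      _ ≤ _ := by
        refine le_trans (le_of_eq ?_) h2
        ring
  have hK2 : K ≤ K ^ 2 := by nlinarith
  have hC : 2 * K ≤ 16 * K ^ 2 := by nlinarith
  have hC1 : 1 ≤ 16 * K ^ 2 := by nlinarith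
  have hC3 : 16 * K ^ 2 ≤ (16 * K ^ 2) ^ 3 := le_self_pow₀ hC1 (by norm_num)
  refine ⟨hε, ?_⟩
  rcases le_total ε 1 with hε1 | hε1
  · have hmin : min (ε ^ 3) ε = ε ^ 3 := min_eq_left (pow_le_of_le_one hε.le hε1 (by norm_num))
    rw [hmin]
    have h1 : Real.log (d * (1 + ε)) ≤ 1 + Real.log d := by
      rw [Real.log_mul hd0.ne' (by positivity)]
      have := Real.log_le_sub_one_of_pos (x := 1 + ε) (by positivity)
      linarith
    calc K * (1 + Real.log (d * (1 + ε))) ≤ K * (2 * (1 + Real.log d)) :=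
          mul_le_mul_of_nonneg_left (by linarith) (by linarith)
      _ = 2 * K * (1 + Real.log d) := by ring
      _ ≤ (16 * K ^ 2) ^ 3 * (1 + Real.log d) :=
          mul_le_mul_of_nonneg_right (hC.trans hC3) (by linarith)
      _ ≤ _ := hcube
  · have hmin : min (ε ^ 3) ε = ε := min_eq_right (le_self_pow₀ hε1 (by norm_num))
    rw [hmin]
    set x := ε * d with hx
    have hx0 : 0 < x := by positivity
    have h1 : (16 * K ^ 2) ^ 3 ≤ x ^ 3 := by
      calc (16 * K ^ 2) ^ 3 ≤ (16 * K ^ 2) ^ 3 * (1 + Real.log d) :=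
            le_mul_of_one_le_right (by positivity) (by linarith)
        _ ≤ ε ^ 3 * d := hcube
        _ ≤ ε ^ 3 * d ^ 3 :=
            mul_le_mul_of_nonneg_left (le_self_pow₀ hd (by norm_num)) (by positivity)
        _ = x ^ 3 := by rw [hx, mul_pow]
    have h2 : 16 * K ^ 2 ≤ x := le_of_pow_le_pow_left₀ (by norm_num) hx0.le h1
    have h3 : 4 * K ≤ √x := Real.le_sqrt_of_sq_le (by linarith)
    have h4 : d * (1 + ε) ≤ (2 * √x) ^ 2 := by
      rw [mul_pow, Real.sq_sqrt hx0.le]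
      nlinarith
    have h5 : Real.log (d * (1 + ε)) ≤ 4 * √x - 2 := by
      have hs : 0 < 2 * √x := by positivity
      calc Real.log (d * (1 + ε)) ≤ Real.log ((2 * √x) ^ 2) :=
            Real.log_le_log (by positivity) h4
        _ = 2 * Real.log (2 * √x) := by rw [Real.log_pow]; norm_num
        _ ≤ 2 * (2 * √x - 1) := by
            have := Real.log_le_sub_one_of_pos hs
            linarith
        _ = _ := by ring
    calc K * (1 + Real.log (d * (1 + ε))) ≤ K * (4 * √x) :=
          mul_le_mul_of_nonneg_left (by linarith) (by linarith)
      _ = 4 * K * √x := by ring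
      _ ≤ √x * √x := mul_le_mul_of_nonneg_right h3 (Real.sqrt_nonneg x)
      _ = x := Real.mul_self_sqrt hx0.le

/-- The numerical facts about `d` and `ε` used in the proof, in terms of `μ = min ε 1`. -/
lemma parameter_bounds {d ε : ℝ} (hd : 1 ≤ d) (hε : 0 < ε)
    (h : 10 ^ 9 * (1 + Real.log (d * (1 + ε))) ≤ min (ε ^ 3) ε * d) :
    min (ε ^ 3) ε * d = d * ε * min ε 1 ^ 2 ∧ 10 ^ 9 ≤ d * ε * min ε 1 ^ 2 ∧
      0 ≤ Real.log (d * (1 + ε)) ∧ 2 ≤ d * (1 + ε) ∧ 10 ^ 9 ≤ d * ε * min ε 1 := by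
  have h1 : min (ε ^ 3) ε * d = d * ε * min ε 1 ^ 2 := by
    rcases le_total ε 1 with hε1 | hε1
    · rw [min_eq_left (pow_le_of_le_one hε.le hε1 (by norm_num)), min_eq_left hε1]
      ring
    · rw [min_eq_right (le_self_pow₀ hε1 (by norm_num)), min_eq_right hε1]
      ring
  have h2 : 0 ≤ Real.log (d * (1 + ε)) := Real.log_nonneg (by nlinarith)
  have h3 : 10 ^ 9 ≤ d * ε * min ε 1 ^ 2 := by rw [← h1]; linarith
  have hμ : 0 < min ε 1 := lt_min hε one_pos
  have hμ1 : min ε 1 ≤ 1 := min_le_right _ _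
  have hdε : 0 < d * ε := by positivity
  have h4 : d * ε * min ε 1 ^ 2 ≤ d * ε * min ε 1 :=
    mul_le_mul_of_nonneg_left (pow_le_of_le_one hμ.le hμ1 (by norm_num)) hdε.le
  refine ⟨h1, h3, h2, ?_, h3.trans h4⟩
  have h5 : d * ε * min ε 1 ≤ d * ε := mul_le_of_le_one_right hdε.le hμ1
  nlinarith

/-- With `t = μ/32` the second-order loss is at most `εd/8` per unit of `t`, leaving a gap of `3ε/8
- ε/4 = ε/8`. -/
lemma chernoff_exponent_le {d ε μ : ℝ} (hd : 0 < d) (hμ : 0 < μ) (hμ1 : μ ≤ 1) (hμε : μ ≤ ε) :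
    (Real.exp (2 * (μ / 32)) - 1) / 2 * (d * (1 + ε / 8)) - μ / 32 * (d * (1 + 3 * ε / 8)) ≤
      -(d * ε * μ / 256) := by
  have hu : |2 * (μ / 32)| ≤ 1 := by
    rw [abs_of_nonneg (by positivity)]
    linarith
  have h1 := (abs_le.1 (Real.abs_exp_sub_one_sub_id_le hu)).2
  have h2 : (Real.exp (2 * (μ / 32)) - 1) / 2 ≤ μ / 32 * (1 + μ / 16) := by nlinarith
  have h3 : (1 + μ / 16) * (1 + ε / 8) ≤ 1 + ε / 4 := by nlinarith
  have h4 : (Real.exp (2 * (μ / 32)) - 1) / 2 * (d * (1 + ε / 8)) ≤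
      μ / 32 * d * (1 + ε / 4) := by
    have hb : 0 ≤ d * (1 + ε / 8) := by have : 0 < ε := hμ.trans_le hμε; positivity
    calc _ ≤ μ / 32 * (1 + μ / 16) * (d * (1 + ε / 8)) := mul_le_mul_of_nonneg_right h2 hb
      _ = μ / 32 * d * ((1 + μ / 16) * (1 + ε / 8)) := by ring
      _ ≤ _ := mul_le_mul_of_nonneg_left h3 (by positivity)
  linarith

lemma union_bound_le {b κθ s : ℝ} (hb : 1 ≤ 4 * b) (h : Real.log (8 * b) ≤ κθ - 2 * s) (k : ℕ) :
    (4 * b) ^ k * (2 ^ (k + 1) * Real.exp (-(κθ * (k + 1)))) ≤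
      Real.exp (-(2 * s) * (k + 1)) := by
  have h8 : 0 < 8 * b := by linarith
  calc (4 * b) ^ k * (2 ^ (k + 1) * Real.exp (-(κθ * (k + 1))))
      ≤ (4 * b) ^ (k + 1) * (2 ^ (k + 1) * Real.exp (-(κθ * (k + 1)))) := by
        refine mul_le_mul_of_nonneg_right ?_ (by positivity)
        exact pow_le_pow_right₀ hb (by omega)
    _ = (8 * b) ^ (k + 1) * Real.exp (-(κθ * (k + 1))) := by
        rw [← mul_assoc, ← mul_pow]
        congr 2
        ring
    _ = Real.exp ((k + 1) * (Real.log (8 * b) - κθ)) := by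
        rw [← Real.exp_log (pow_pos h8 (k + 1)), ← Real.exp_add, Real.log_pow]
        congr 1
        push_cast
        ring
    _ ≤ _ := by
        refine Real.exp_le_exp.2 ?_
        nlinarith [Nat.cast_nonneg (α := ℝ) k]

lemma one_add_le_growth_ratio {d ε μ : ℝ} (hd : 0 < d) (hμ : 0 < μ) (hμ1 : μ ≤ 1)
    (hμε : μ ≤ ε) : 1 + μ / 3 ≤ d * (1 + ε) / (d * (1 + ε / 2)) := by
  have hε : 0 < ε := hμ.trans_le hμε
  rw [mul_div_mul_left _ _ hd.ne', le_div_iff₀ (by positivity)]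
  nlinarith

lemma tendsto_sbm_isSparse_of_large {d lam ε : ℝ} (hd : 1 ≤ d) (hlam : |lam| ≤ √d) (hε : 0 < ε)
    (h : 10 ^ 9 * (1 + Real.log (d * (1 + ε))) ≤ min (ε ^ 3) ε * d) :
    Tendsto (fun n : ℕ => (sbm n d lam).real {G | IsSparse G (min ε 1 / 1100)
      (d * (1 + ε / 2)) (Real.exp (-(min (ε ^ 3) ε * d / 1126400)))}) atTop (𝓝 1) := by
  obtain ⟨h1, h2, h3, h4, h5⟩ := parameter_bounds hd hε h
  rw [h1] at h ⊢
  set μ := min ε 1 with hμdef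
  have hμ : 0 < μ := lt_min hε one_pos
  have hμ1 : μ ≤ 1 := min_le_right _ _
  have hμε : μ ≤ ε := min_le_left _ _
  have hd0 : 0 < d := by linarith
  have hb0 : 0 < d * (1 + ε / 8) := by positivity
  -- The excess `ε/2` in `A` is split into `3ε/8` for outgoing edges and `ε/8` for `1/θ`. Here `κθ =
  -- Λ/281600` and `s = κθ/4`, so half of `κθ` is left to pay for `log(8b)`.
  refine tendsto_sbm_isSparse (τ := ε / 8) (t := μ / 32) (a := d * (1 + 3 * ε / 8))
    (κ := d * ε * μ / 256) hd hlam (by positivity) (by positivity) (by positivity)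
    (chernoff_exponent_le hd0 hμ hμ1 hμε) (by positivity) ?_ (by linarith) ?_
  · have h6 : 1 / (μ / 1100) ≤ d * ε / 8 := by
      rw [one_div_div, div_le_iff₀ hμ]
      linarith
    linarith
  · intro k
    have h7 : d * ε * μ / 256 * (μ / 1100) = d * ε * μ ^ 2 / 281600 := by ring
    rw [h7]
    refine union_bound_le (by nlinarith) ?_ k
    have h8 : Real.log (8 * (d * (1 + ε / 8))) ≤ Real.log 8 + Real.log (d * (1 + ε)) := by
      rw [Real.log_mul (by norm_num) hb0.ne']
      have : d * (1 + ε / 8) ≤ d * (1 + ε) := by nlinarith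
      linarith [Real.log_le_log hb0 this]
    have h9 : Real.log 8 ≤ 7 := by
      have := Real.log_le_sub_one_of_pos (x := 8) (by norm_num)
      linarith
    linarith

lemma sumSqNontrivial_le_exp {n : ℕ} {d ε : ℝ} (hd : 1 ≤ d) (hε : 0 < ε)
    (h : 10 ^ 9 * (1 + Real.log (d * (1 + ε))) ≤ min (ε ^ 3) ε * d) {G : SimpleGraph (Fin n)}
    (hG : IsSparse G (min ε 1 / 1100) (d * (1 + ε / 2))
      (Real.exp (-(min (ε ^ 3) ε * d / 1126400)))) :
    sumSqNontrivial (excision G (d * (1 + ε))) ≤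
      Real.exp (-(1 / 4505600 * min (ε ^ 3) ε * d)) * n := by
  obtain ⟨h1, h2, h3, h4, -⟩ := parameter_bounds hd hε h
  have hμ : 0 < min ε 1 := lt_min hε one_pos
  have hΛ : 10 ^ 9 ≤ min (ε ^ 3) ε * d := h1 ▸ h2
  set Λ := min (ε ^ 3) ε * d with hΛdef
  have hD0 : 0 < d * (1 + ε) := by linarith
  -- Half of the exponent absorbs `D^50`; half of the remainder then absorbs the factor 2 of the
  -- geometric series.
  have hexp : Real.exp (-(Λ / 1126400)) * (d * (1 + ε)) ^ 50 ≤ Real.exp (-(Λ / 2252800)) := by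
    rw [← Real.exp_log (pow_pos hD0 50), ← Real.exp_add, Real.log_pow]
    refine Real.exp_le_exp.2 ?_
    push_cast
    linarith
  have hhalf : Real.exp (-(Λ / 4505600)) ≤ 1 / 2 := by
    have h6 := Real.add_one_le_exp (Λ / 4505600)
    rw [Real.exp_neg, inv_le_comm₀ (Real.exp_pos _) (by norm_num)]
    norm_num
    linarith
  have hsplit : Real.exp (-(Λ / 2252800)) =
      Real.exp (-(Λ / 4505600)) * Real.exp (-(Λ / 4505600)) := by
    rw [← Real.exp_add]
    congr 1
    ring
  have hpos := Real.exp_pos (-(Λ / 4505600))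
  have hle := sumSqNontrivial_le (by nlinarith) h4 hμ (min_le_right _ _)
    (one_add_le_growth_ratio (by linarith) hμ (min_le_right _ _) (min_le_left _ _))
    (Real.exp_pos _).le (hexp.trans (by rw [hsplit]; nlinarith)) hG
  refine hle.trans (mul_le_mul_of_nonneg_right ?_ (Nat.cast_nonneg n))
  have h7 : -(1 / 4505600 * min (ε ^ 3) ε * d) = -(Λ / 4505600) := by rw [hΛdef]; ring
  rw [h7]
  nlinarith

lemma eventually_mul_log_pow_le (K : ℝ) (m : ℕ) {e : ℝ} (he : 0 < e) :
    ∀ᶠ n : ℕ in atTop, K * (Real.log n + 1) ^ m ≤ (n : ℝ) ^ e := by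
  have h1 := (isLittleO_log_rpow_rpow_atTop (m : ℝ) he).comp_tendsto
    tendsto_natCast_atTop_atTop
  have h2 := h1.def (c := 1 / ((|K| + 1) * 2 ^ m)) (by positivity)
  filter_upwards [h2, eventually_ge_atTop 3] with n hn hn3
  have hn3' : (3 : ℝ) ≤ n := by exact_mod_cast hn3
  have hlog : 1 ≤ Real.log n := by
    rw [Real.le_log_iff_exp_le (by linarith)]
    exact Real.exp_one_lt_three.le.trans hn3'
  simp only [Function.comp_apply, Real.rpow_natCast] at hn
  rw [Real.norm_of_nonneg (by positivity), Real.norm_of_nonneg (by positivity),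
    one_div_mul_eq_div, le_div_iff₀ (by positivity)] at hn
  calc K * (Real.log n + 1) ^ m ≤ (|K| + 1) * (2 * Real.log n) ^ m := by
        refine mul_le_mul (by linarith [le_abs_self K]) ?_ (by positivity) (by positivity)
        exact pow_le_pow_left₀ (by positivity) (by linarith) m
    _ = Real.log n ^ m * ((|K| + 1) * 2 ^ m) := by rw [mul_pow]; ring
    _ ≤ _ := hn

/-- A component controlled by a set of at most `log n` vertices and by a radius that is
logarithmic in the size of that set is polylogarithmic. -/
lemma card_le_polylog {D x ℓ k N : ℝ} {a R : ℕ} (hD : 1 ≤ D) (ha : D ≤ x ^ a)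
    (hk0 : 0 ≤ k) (hk : k ≤ ℓ) (hR : 1 ≤ R) (hx : 1 ≤ x) (hxR : x ^ (R - 1) < k + 1)
    (hN : N ≤ k * D ^ (12 * R)) : N ≤ D ^ 12 * (ℓ + 1) ^ (12 * a + 1) := by
  obtain ⟨r, rfl⟩ := Nat.exists_eq_add_of_le' hR
  rw [Nat.add_sub_cancel] at hxR
  have h1 : D ^ (12 * r) ≤ (ℓ + 1) ^ (12 * a) := by
    calc D ^ (12 * r) ≤ (x ^ a) ^ (12 * r) := pow_le_pow_left₀ (by linarith) ha _
      _ = (x ^ r) ^ (12 * a) := by rw [← pow_mul, ← pow_mul]; congr 1; ring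
      _ ≤ (ℓ + 1) ^ (12 * a) := pow_le_pow_left₀ (by positivity) (by linarith) _
  calc N ≤ k * D ^ (12 * (r + 1)) := hN
    _ = D ^ 12 * (k * D ^ (12 * r)) := by ring
    _ ≤ D ^ 12 * ((ℓ + 1) * (ℓ + 1) ^ (12 * a)) := by
        refine mul_le_mul_of_nonneg_left ?_ (by positivity)
        exact mul_le_mul (by linarith) h1 (by positivity) (by linarith)
    _ = _ := by ring

lemma card_le_rpow_of_mul_le_log {D Λ : ℝ} {n k R : ℕ} {N : ℝ} (hD : 2 ≤ D) (hΛ : 0 < Λ)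
    (hn : 0 < n) (hk : Λ / 1126400 * k ≤ Real.log n) (hR : R ≤ 2 * k)
    (hN : N ≤ k * D ^ (12 * R)) : N ≤ (n : ℝ) ^ (28160000 * Real.log D / Λ) := by
  have hn' : (0 : ℝ) < n := by exact_mod_cast hn
  have hD1 : 1 ≤ D := by linarith
  have hD0 : 0 < D := by linarith
  have hlog : 0 ≤ Real.log D := Real.log_nonneg hD1
  have h1 : (k : ℝ) ≤ D ^ k := by
    calc (k : ℝ) ≤ 2 ^ k := by exact_mod_cast Nat.lt_two_pow_self.le
      _ ≤ D ^ k := pow_le_pow_left₀ zero_le_two hD _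
  calc N ≤ k * D ^ (12 * R) := hN
    _ ≤ D ^ k * D ^ (24 * k) :=
        mul_le_mul h1 (pow_le_pow_right₀ hD1 (by omega)) (by positivity) (by positivity)
    _ = Real.exp (25 * k * Real.log D) := by
        rw [← pow_add, ← Real.exp_log (pow_pos hD0 _), Real.log_pow]
        congr 1
        push_cast
        ring
    _ ≤ Real.exp (Real.log n * (28160000 * Real.log D / Λ)) := by
        refine Real.exp_le_exp.2 ?_
        have h2 : (k : ℝ) ≤ Real.log n * 1126400 / Λ := by
          rw [le_div_iff₀ hΛ]
          linarith
        calc 25 * k * Real.log D ≤ 25 * (Real.log n * 1126400 / Λ) * Real.log D := by gcongr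
          _ = _ := by ring
    _ = _ := (Real.rpow_def_of_pos hn' _).symm

lemma eventually_card_component_le {d ε : ℝ} (hd : 1 ≤ d) (hε : 0 < ε)
    (h : 10 ^ 9 * (1 + Real.log (d * (1 + ε))) ≤ min (ε ^ 3) ε * d) :
    ∀ᶠ n : ℕ in atTop, ∀ G : SimpleGraph (Fin n),
      IsSparse G (min ε 1 / 1100) (d * (1 + ε / 2))
        (Real.exp (-(min (ε ^ 3) ε * d / 1126400))) →
      ∀ C : (excision G (d * (1 + ε))).ConnectedComponent,
        (C.supp.ncard : ℝ) ≤
          (n : ℝ) ^ (28160000 * Real.log (d * (1 + ε)) / (ε ^ 3 * d)) := by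
  obtain ⟨h1, h2, h3, h4, -⟩ := parameter_bounds hd hε h
  have hμ : 0 < min ε 1 := lt_min hε one_pos
  have hd0 : 0 < d := by linarith
  have hΛ : 10 ^ 9 ≤ min (ε ^ 3) ε * d := h1 ▸ h2
  have hA : 1 ≤ d * (1 + ε / 2) := by nlinarith
  have hratio := one_add_le_growth_ratio hd0 hμ (min_le_right ε 1) (min_le_left ε 1)
  have hlogD : 0 < Real.log (d * (1 + ε)) := Real.log_pos (by linarith)
  have hx1 : 1 < d * (1 + ε) / (d * (1 + ε / 2)) := by linarith
  obtain ⟨a, ha⟩ := pow_unbounded_of_one_lt (d * (1 + ε)) hx1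
  have he : 0 < 28160000 * Real.log (d * (1 + ε)) / (ε ^ 3 * d) := by positivity
  filter_upwards [eventually_gt_atTop 0,
    eventually_mul_log_pow_le ((d * (1 + ε)) ^ 12) (12 * a + 1) he] with n hn hpoly G hG C
  have hn1 : (1 : ℝ) ≤ n := by exact_mod_cast hn
  rcases le_or_gt C.supp.ncard 1 with hC | hC
  · calc (C.supp.ncard : ℝ) ≤ 1 := by exact_mod_cast hC
      _ ≤ _ := Real.one_le_rpow hn1 he.le
  obtain ⟨T, R, hT, -, hR1, hR, hTR, hcard⟩ :=
    exists_expanding_of_nontrivial hA h4 hμ (min_le_right ε 1) hratio C hC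
  have hlog := mul_card_le_log hG hT
  rcases le_total ε 1 with hε1 | hε1
  · have hmin : min (ε ^ 3) ε = ε ^ 3 := min_eq_left (pow_le_of_le_one hε.le hε1 (by norm_num))
    rw [hmin] at hlog
    exact card_le_rpow_of_mul_le_log h4 (by positivity) hn hlog hR hcard
  -- For `ε ≥ 1` sparsity only has rate `εd`, too weak for an exponent with `ε³d` in the
  -- denominator. The radius is logarithmic in `|T| ≤ log n`, so the component is polylogarithmic,
  -- below any fixed power of `n`.
  · refine (card_le_polylog (by linarith) ha.le (Nat.cast_nonneg T.card) ?_ hR1 hx1.le hTR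
      hcard).trans hpoly
    have hTnn : (0 : ℝ) ≤ T.card := Nat.cast_nonneg _
    nlinarith

end Parameters

end SBMExcision

end

theorem lemma4p9 :
    ∃ C₁ C₂ c c' : ℝ, 0 < C₁ ∧ 0 < C₂ ∧ 0 < c ∧ 0 < c' ∧
      ∀ d lam ε : ℝ, 1 ≤ d → |lam| ≤ √d →
        C₁ * ((C₂ + Real.log d) / d) ^ (1 / 3 : ℝ) ≤ ε →
        Tendsto
          (fun n : ℕ => (SBMExcision.sbm n d lam).real
            {G | SBMExcision.sumSqNontrivial (SBMExcision.excision G (d * (1 + ε))) ≤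
              Real.exp (-(c * min (ε ^ 3) ε * d)) * n})
          atTop (𝓝 1) ∧
        Tendsto
          (fun n : ℕ => (SBMExcision.sbm n d lam).real
            {G | ∀ C : (SBMExcision.excision G (d * (1 + ε))).ConnectedComponent,
              (C.supp.ncard : ℝ) ≤
                (n : ℝ) ^ (c' * Real.log (d * (1 + ε)) / (ε ^ 3 * d))})
          atTop (𝓝 1) := by
  refine ⟨16 * (10 ^ 9) ^ 2, 1, 1 / 4505600, 28160000, by norm_num, by norm_num, by norm_num,
    by norm_num, ?_⟩
  intro d lam ε hd hlam hε'
  obtain ⟨hε, hlarge⟩ := SBMExcision.mul_one_add_log_le (by norm_num) hd hε'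
  have hlim := SBMExcision.tendsto_sbm_isSparse_of_large hd hlam hε hlarge
  refine ⟨?_, ?_⟩
  · refine tendsto_of_tendsto_of_tendsto_of_le_of_le hlim tendsto_const_nhds
      (fun n => measureReal_mono fun G hG => ?_) fun n => measureReal_le_one
    exact SBMExcision.sumSqNontrivial_le_exp hd hε hlarge hG
  · refine tendsto_of_tendsto_of_tendsto_of_le_of_le' hlim tendsto_const_nhds ?_
      (Eventually.of_forall fun n => measureReal_le_one)
    filter_upwards [SBMExcision.eventually_card_component_le hd hε hlarge] with n hn
    exact measureReal_mono fun G hG => hn G hG
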